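/- Let $f\in\mathbb{C}[x,y,z]$ be a ternary quartic form defining a smooth plane curve. Let $K\subset\mathbb{C}$ be a subfield over which all bitangents of $f$ are defined, that is, $K$ contains the ratios of the coefficients of every linear form $\ell\neq 0$ such that $f=g^2+\ell h$ for some complex quadratic form $g$ and cubic form $h$. (In the main case $f$ has rational coefficients and $K$ is generated over $\mathbb{Q}$ by these ratios.) Let $M=xA+yB+zC$ with symmetric $4\times4$ matrices $A,B,C$ over $K$ such that $\det M=\gamma f$ for some $\gamma\in\mathbb{C}\setminus\{0\}$, and let the eight points $P_1,\dots,P_8\in\mathbb{P}^3(\mathbb{C})$, in any order, be the Cayley octad of $M$, that is, the set of common zeros of the three quadrics $uAu^T,uBu^T,uCu^T$. Then the points $P_1,\dots,P_8$ are $K$-rational. For every $8\times 4$ matrix $Q$ over $K$ whose rows represent $P_1,\dots,P_8$, the following holds. (a) Let $M_{1234}$ be the upper left $4\times4$ block of $QMQ^T$, and let $S$ be the matrix formed by the first four rows of $Q$. Then $S$ is invertible, the rows of $O:=QS^{-1}$ represent the Cayley octad of $M_{1234}$, the first four rows of $O$ are the standard basis vectors, all entries of its last four rows are nonzero, and $OM_{1234}O^T=QMQ^T$.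 Write $OM_{1234}O^T=(b_{ij})_{1\le i,j\le 8}$ for the bitangent matrix of $M_{1234}$. (b) Let $$M'_{1234}=\begin{pmatrix}0&b_{34}&b_{24}&b_{23}\\ b_{34}&0&b_{14}&b_{13}\\ b_{24}&b_{14}&0&b_{12}\\ b_{23}&b_{13}&b_{12}&0\end{pmatrix}$$ be the bifid substitution of $M_{1234}$. Let $O'$ be any $8\times4$ matrix over $K$ whose $i$-th row is a nonzero $K$-multiple of the $i$-th row of $O$ for $i\le 4$, and of the vector of reciprocals of the entries of the $i$-th row of $O$ for $i\ge 5$. Then the rows of $O'$ represent the Cayley octad of $M'_{1234}$. Write $O'M'_{1234}O'^T=(b'_{ij})_{1\le i,j\le8}$ for the bitangent matrix of $M'_{1234}$. (c) For all $i,j,k,l\in\{1,\dots,8\}$ there are nonzero scalars in $K$ by which $$b'_{ij}\ \text{ is a multiple of }\ \begin{cases} b_{kl} & \text{if } \{i,j,k,l\}=\{1,2,3,4\},\\ b_{ij} & \text{if } i\neq j \text{ and } |\{i,j\}\cap\{1,2,3,4\}|=1,\\ b_{kl} & \text{if } \{i,j,k,l\}=\{5,6,7,8\}.\end{cases}$$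 -/

import Mathlib

open MvPolynomial

/-- The linear form `a₀ x + a₁ y + a₂ z`. -/
noncomputable def linearForm {F : Type*} [Field F] (a : Fin 3 → F) : MvPolynomial (Fin 3) F :=
  ∑ t, C (a t) * X t

/-- The plane curve `f = 0` over `ℂ` has no singular point in the projective plane. -/
def IsSmoothForm (f : MvPolynomial (Fin 3) ℂ) : Prop :=
  ∀ p : Fin 3 → ℂ, eval p f = 0 → (∀ t, eval p (pderiv t f) = 0) → p = 0

/-- The line `a₀ x + a₁ y + a₂ z = 0` is a bitangent of the quartic `f`:
there are a quadric `g` and a cubic `h` with `f = g² + ℓ h`. -/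
def IsBitangent (f : MvPolynomial (Fin 3) ℂ) (a : Fin 3 → ℂ) : Prop :=
  a ≠ 0 ∧ ∃ g h : MvPolynomial (Fin 3) ℂ, g.IsHomogeneous 2 ∧ h.IsHomogeneous 3 ∧
    f = g ^ 2 + linearForm a * h

/-- The smallest subfield of `ℂ` over which all bitangents `(α : β : γ)` of `f` are defined.
As the coefficients of a line are only defined up to a common factor, it is generated by their
ratios. -/
noncomputable def bitangentField (f : MvPolynomial (Fin 3) ℂ) : IntermediateField ℚ ℂ :=
  IntermediateField.adjoin ℚ
    {r : ℂ | ∃ a : Fin 3 → ℂ, IsBitangent f a ∧ ∃ s t, a t ≠ 0 ∧ r = a s / a t}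

/-- The matrix of linear forms `M = x A₀ + y A₁ + z A₂`. -/
noncomputable def linearMatrix {F : Type*} [Field F] {n : Type*} (A : Fin 3 → Matrix n n F) :
    Matrix n n (MvPolynomial (Fin 3) F) :=
  Matrix.of fun i j => linearForm fun t => A t i j

/-- The rows of `O` and of `O'` represent the same points of projective space. -/
def SamePoints {F : Type*} [Field F] (O O' : Matrix (Fin 8) (Fin 4) F) : Prop :=
  ∀ i, ∃ c : F, c ≠ 0 ∧ O i = c • O' i

/-- The rows of `O` represent eight distinct points of `ℙ³(ℂ)`, and these are exactly the common
zeros of the three quadrics `u A₀ uᵀ`, `u A₁ uᵀ`, `u A₂ uᵀ`. -/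
def IsCayleyOctad (A : Fin 3 → Matrix (Fin 4) (Fin 4) ℂ) (O : Matrix (Fin 8) (Fin 4) ℂ) : Prop :=
  (∀ i, O i ≠ 0) ∧
  (∀ i j, ∀ c : ℂ, O i = c • O j → i = j) ∧
  ∀ u : Fin 4 → ℂ, u ≠ 0 →
    ((∀ t, u ⬝ᵥ (A t).mulVec u = 0) ↔ ∃ i, ∃ c : ℂ, u = c • O i)

/-- The bitangent matrix `O M Oᵀ = (b i j)`, where `M = x A₀ + y A₁ + z A₂`. -/
noncomputable def bitangentMatrix {F : Type*} [Field F] (A : Fin 3 → Matrix (Fin 4) (Fin 4) F)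
    (O : Matrix (Fin 8) (Fin 4) F) : Matrix (Fin 8) (Fin 8) (MvPolynomial (Fin 3) F) :=
  Matrix.map O (C : F →+* MvPolynomial (Fin 3) F) * linearMatrix A *
    (Matrix.map O (C : F →+* MvPolynomial (Fin 3) F)).transpose

/-- The inclusion of the first four of the eight indices. -/
def firstFour : Fin 4 → Fin 8 := Fin.castLE (by norm_num)

/-- The coefficient matrices of `M₁₂₃₄`, the upper left `4 × 4` block of the bitangent matrix;
see `linearMatrix_principalBlock`. -/
def principalBlock {F : Type*} [Field F] (A : Fin 3 → Matrix (Fin 4) (Fin 4) F)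
    (O : Matrix (Fin 8) (Fin 4) F) : Fin 3 → Matrix (Fin 4) (Fin 4) F :=
  fun t => (O * A t * O.transpose).submatrix firstFour firstFour

theorem linearMatrix_principalBlock {F : Type*} [Field F]
    (A : Fin 3 → Matrix (Fin 4) (Fin 4) F) (O : Matrix (Fin 8) (Fin 4) F) :
    linearMatrix (principalBlock A O) = (bitangentMatrix A O).submatrix firstFour firstFour := by
  ext1 i j
  simp only [linearMatrix, principalBlock, bitangentMatrix, linearForm, Matrix.of_apply,
    Matrix.submatrix_apply, Matrix.mul_apply, Matrix.map_apply, Matrix.transpose_apply,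
    Fin.sum_univ_three, Fin.sum_univ_four, map_add, map_mul]
  ring

/-- The bifid substitution on a `4 × 4` matrix: off the diagonal the entry at `(i, j)` becomes the
entry at `(k, l)`, where `{i, j, k, l}` is the full index set. -/
def bifidMatrix {R : Type*} [Zero R] (N : Matrix (Fin 4) (Fin 4) R) : Matrix (Fin 4) (Fin 4) R :=
  !![0, N 2 3, N 1 3, N 1 2;
     N 2 3, 0, N 0 3, N 0 2;
     N 1 3, N 0 3, 0, N 0 1;
     N 1 2, N 0 2, N 0 1, 0]

/-- The coefficient matrices of `M'₁₂₃₄`. -/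
def bifidBlock {F : Type*} [Field F] (A : Fin 3 → Matrix (Fin 4) (Fin 4) F)
    (O : Matrix (Fin 8) (Fin 4) F) : Fin 3 → Matrix (Fin 4) (Fin 4) F :=
  fun t => bifidMatrix (principalBlock A O t)

theorem linearMatrix_bifidBlock {F : Type*} [Field F]
    (A : Fin 3 → Matrix (Fin 4) (Fin 4) F) (O : Matrix (Fin 8) (Fin 4) F) :
    linearMatrix (bifidBlock A O) = bifidMatrix (linearMatrix (principalBlock A O)) := by
  ext1 i j
  fin_cases i <;> fin_cases j <;> simp [linearMatrix, bifidBlock, bifidMatrix, linearForm]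

/-- The octad `O` in the coordinates in which its first four points are the standard basis
vectors: `O P⁻¹`, where `P` consists of the first four rows of `O`. -/
noncomputable def normalizedOctad {F : Type*} [Field F] (O : Matrix (Fin 8) (Fin 4) F) :
    Matrix (Fin 8) (Fin 4) F :=
  O * (O.submatrix firstFour id)⁻¹

/-- The Cremona transformation at the first four points, in coordinates in which these are the
standard basis vectors: they are kept, and all coordinates of the other four points are inverted. -/
noncomputable def cremonaOctad {F : Type*} [Field F] (O : Matrix (Fin 8) (Fin 4) F) :
    Matrix (Fin 8) (Fin 4) F :=
  Matrix.of fun i j => if i.val < 4 then O i j else (O i j)⁻¹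

/-- Entrywise inclusion of a matrix over a subfield of `ℂ` into the complex matrices. -/
noncomputable def toComplex {K : IntermediateField ℚ ℂ} {m n : Type*} (N : Matrix m n K) : Matrix m n ℂ :=
  N.map (algebraMap K ℂ)

/-! Let b_ij be the linear form with coefficient vector `polarVec A (O i) (O j)`. Smoothness enters
through one remark: if u is a common zero of the net, take a basis starting with u. The determinant
then has a zero corner, and a common zero of its first row would be a singular point of the curve.
So the polars of u span all linear forms (`eq_zero_of_polarVec_dotProduct`). Hence b_ij ≠ 0 for i ≠
j, no four points of the octad are coplanar, and different pairs give different lines. Expanding a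
symmetric determinant with zero diagonal as g² + b_ij h shows that every b_ij is a bitangent.

Rationality: an embedding over K permutes the octad, because the net is defined over K, and
preserves each b_ij up to a scalar, because the ratios of its coefficients lie in K. Since different
pairs give different bitangents, the permutation is trivial, so suitably normalized coordinates are
fixed and lie in K.

Bifid substitution: once the first four points are the basis vectors, all quadrics have zero
diagonal, and the inversion x ↦ 1/x turns them into their bifid substitutions. The determinant is
unchanged, so the new net is again smooth and its octad is the Cremona image. The bitangents within
the first four points are matrix entries. The mixed ones come from differentiating the inversion
identity (`bifidMatrix_single_inv`). For the last four (`IsCayleyOctad.polarVec_complementary`), the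
quadrics whose transforms contain the line through O'_i and O'_j form a pencil through a twisted
cubic; the residual intersection of that pencil is the chord through O_k and O_l, so b'_ij and b_kl
vanish on the same parameters. -/

/-! ### Polarization of a net of quadrics and change of basis. -/

section PolarVector

variable {F : Type*} [Field F]

/-- The vector of the three values `u A_t vᵀ`. -/
def polarVec (A : Fin 3 → Matrix (Fin 4) (Fin 4) F) (u v : Fin 4 → F) : Fin 3 → F :=
  fun t => u ⬝ᵥ (A t).mulVec v

variable (A : Fin 3 → Matrix (Fin 4) (Fin 4) F)

theorem polarVec_add_right (u v w : Fin 4 → F) :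
    polarVec A u (v + w) = polarVec A u v + polarVec A u w := by
  ext t; simp [polarVec, Matrix.mulVec_add, dotProduct_add]

theorem polarVec_add_left (u v w : Fin 4 → F) :
    polarVec A (u + v) w = polarVec A u w + polarVec A v w := by
  ext t; simp [polarVec, add_dotProduct]

theorem polarVec_smul_right (c : F) (u v : Fin 4 → F) :
    polarVec A u (c • v) = c • polarVec A u v := by
  ext t; simp [polarVec, Matrix.mulVec_smul]

theorem polarVec_smul_left (c : F) (u v : Fin 4 → F) :
    polarVec A (c • u) v = c • polarVec A u v := by
  ext t; simp [polarVec]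

variable {A} in
theorem polarVec_comm (hA : ∀ t, (A t).IsSymm) (u v : Fin 4 → F) :
    polarVec A u v = polarVec A v u := by
  ext t
  rw [polarVec, polarVec, dotProduct_comm, ← Matrix.vecMul_transpose, (hA t).eq,
    Matrix.dotProduct_mulVec]

theorem mul_mul_transpose_apply {m : Type*} (O : Matrix m (Fin 4) F) (N : Matrix (Fin 4) (Fin 4) F)
    (i j : m) : (O * N * O.transpose) i j = O i ⬝ᵥ N.mulVec (O j) := by
  rw [Matrix.mul_assoc, Matrix.mul_apply_eq_vecMul, Matrix.vecMul, dotProduct]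
  rfl

theorem linearForm_smul (c : F) (a : Fin 3 → F) : linearForm (c • a) = c • linearForm a := by
  simp [linearForm, Finset.smul_sum, MvPolynomial.smul_eq_C_mul, mul_assoc]

theorem linearForm_zero : linearForm (0 : Fin 3 → F) = 0 := by
  simp [linearForm]

theorem linearForm_isHomogeneous (a : Fin 3 → F) : (linearForm a).IsHomogeneous 1 :=
  IsHomogeneous.sum _ _ _ fun t _ => by simpa using (isHomogeneous_C_mul_X (a t) t)

theorem eval_linearForm (p a : Fin 3 → F) : eval p (linearForm a) = a ⬝ᵥ p := by
  simp [linearForm, dotProduct]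

theorem bitangentMatrix_apply (O : Matrix (Fin 8) (Fin 4) F) (i j : Fin 8) :
    bitangentMatrix A O i j = linearForm (polarVec A (O i) (O j)) := by
  simp only [bitangentMatrix, linearMatrix, linearForm, polarVec, Matrix.mul_apply, dotProduct,
    Matrix.mulVec, Matrix.map_apply, Matrix.of_apply, Matrix.transpose_apply,
    Fin.sum_univ_three, Fin.sum_univ_four, map_add, map_mul]
  ring

/-- The net of quadrics in the coordinates given by the rows of `S`. -/
def baseChange (S : Matrix (Fin 4) (Fin 4) F) : Fin 3 → Matrix (Fin 4) (Fin 4) F :=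
  fun t => S * A t * S.transpose

theorem linearMatrix_baseChange (S : Matrix (Fin 4) (Fin 4) F) :
    linearMatrix (baseChange A S) = S.map (C : F →+* MvPolynomial (Fin 3) F) * linearMatrix A *
      (S.map (C : F →+* MvPolynomial (Fin 3) F)).transpose := by
  ext1 i j
  simp only [linearMatrix, baseChange, linearForm, Matrix.of_apply,
    Matrix.mul_apply, Matrix.map_apply, Matrix.transpose_apply,
    Fin.sum_univ_three, Fin.sum_univ_four, map_add, map_mul]
  ring

theorem det_linearMatrix_baseChange (S : Matrix (Fin 4) (Fin 4) F) :
    (linearMatrix (baseChange A S)).det = C (S.det ^ 2) * (linearMatrix A).det := by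
  have h : (S.map (C : F →+* MvPolynomial (Fin 3) F)).det = C S.det :=
    ((C : F →+* MvPolynomial (Fin 3) F).map_det S).symm
  rw [linearMatrix_baseChange, Matrix.det_mul, Matrix.det_mul, Matrix.det_transpose, h, map_pow]
  ring

theorem linearMatrix_baseChange_apply (S : Matrix (Fin 4) (Fin 4) F) (i j : Fin 4) :
    linearMatrix (baseChange A S) i j = linearForm (polarVec A (S i) (S j)) := by
  simp only [linearMatrix, baseChange, mul_mul_transpose_apply, Matrix.of_apply]
  rfl

theorem polarVec_baseChange (S : Matrix (Fin 4) (Fin 4) F) (u v : Fin 4 → F) :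
    polarVec (baseChange A S) u v = polarVec A (Matrix.vecMul u S) (Matrix.vecMul v S) := by
  ext t
  simp [polarVec, baseChange, ← Matrix.mulVec_mulVec, Matrix.mulVec_transpose,
    Matrix.dotProduct_mulVec, Matrix.vecMul_vecMul, Matrix.mul_assoc]

variable {A} in
theorem baseChange_isSymm (hA : ∀ t, (A t).IsSymm) (S : Matrix (Fin 4) (Fin 4) F) (t : Fin 3) :
    (baseChange A S t).IsSymm := by
  simp [Matrix.IsSymm, baseChange, (hA t).eq, Matrix.mul_assoc]

end PolarVector

/-! ### Symmetric 4 × 4 determinants. -/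

section Determinants

variable {R : Type*} [CommRing R]

theorem det_symm_four (a b c d e f g h i j : R) :
    (!![a, b, c, d; b, e, f, g; c, f, h, i; d, g, i, j] : Matrix (Fin 4) (Fin 4) R).det =
      a * (e * (h * j - i ^ 2) - f * (f * j - i * g) + g * (f * i - h * g))
      - b ^ 2 * (h * j - i ^ 2) - c ^ 2 * (e * j - g ^ 2) - d ^ 2 * (e * h - f ^ 2)
      + 2 * (b * c * (f * j - i * g)) - 2 * (b * d * (f * i - h * g))
      + 2 * (c * d * (e * i - f * g)) := by
  simp [Matrix.det_succ_row_zero, Fin.sum_univ_succ, Fin.succAbove]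
  ring

theorem symm_four_eta {α : Type*} {M : Matrix (Fin 4) (Fin 4) α} (hM : ∀ i j, M i j = M j i) :
    M = !![M 0 0, M 0 1, M 0 2, M 0 3; M 0 1, M 1 1, M 1 2, M 1 3;
      M 0 2, M 1 2, M 2 2, M 2 3; M 0 3, M 1 3, M 2 3, M 3 3] := by
  ext i j
  fin_cases i <;> fin_cases j <;> first | rfl | exact hM _ _

/-- With a zero corner, every term of the expansion has one factor from the first row and another
from the first column. -/
theorem det_mem_sq_of_row {M : Matrix (Fin 4) (Fin 4) R} (hM : ∀ i j, M i j = M j i)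
    {I : Ideal R} (h0 : M 0 0 = 0) (hI : ∀ j, M 0 j ∈ I) : M.det ∈ I ^ 2 := by
  have key (j k : Fin 4) (r : R) : M 0 j * M 0 k * r ∈ I ^ 2 :=
    Ideal.mul_mem_right _ _ (by rw [pow_two]; exact Ideal.mul_mem_mul (hI j) (hI k))
  rw [symm_four_eta hM, det_symm_four, h0]
  have h := (I ^ 2).add_mem ((I ^ 2).add_mem ((I ^ 2).add_mem ((I ^ 2).add_mem ((I ^ 2).add_mem
    (key 1 1 (-(M 2 2 * M 3 3 - M 2 3 ^ 2))) (key 2 2 (-(M 1 1 * M 3 3 - M 1 3 ^ 2))))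
    (key 3 3 (-(M 1 1 * M 2 2 - M 1 2 ^ 2)))) (key 1 2 (2 * (M 1 2 * M 3 3 - M 2 3 * M 1 3))))
    (key 1 3 (-2 * (M 1 2 * M 2 3 - M 2 2 * M 1 3)))) (key 2 3 (2 * (M 1 1 * M 2 3 - M 1 2 * M 1 3)))
  convert h using 1
  ring

/-- The last row and column account for at most two factors of a term, so at least two come from the
upper left 3 × 3 block. -/
theorem det_mem_sq_of_block {M : Matrix (Fin 4) (Fin 4) R} (hM : ∀ i j, M i j = M j i)
    {I : Ideal R} (hd : ∀ i : Fin 4, i ≠ 3 → M i i = 0)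
    (h01 : M 0 1 ∈ I) (h02 : M 0 2 ∈ I) (h12 : M 1 2 ∈ I) : M.det ∈ I ^ 2 := by
  have key {a b : R} (ha : a ∈ I) (hb : b ∈ I) (r : R) : a * b * r ∈ I ^ 2 :=
    Ideal.mul_mem_right _ _ (by rw [pow_two]; exact Ideal.mul_mem_mul ha hb)
  rw [symm_four_eta hM, det_symm_four, hd 0 (by decide), hd 1 (by decide), hd 2 (by decide)]
  have h := (I ^ 2).add_mem ((I ^ 2).add_mem ((I ^ 2).add_mem ((I ^ 2).add_mem ((I ^ 2).add_mem
    (key h01 h01 (M 2 3 ^ 2)) (key h02 h02 (M 1 3 ^ 2))) (key h12 h12 (M 0 3 ^ 2)))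
    (key h01 h02 (2 * (M 1 2 * M 3 3 - M 2 3 * M 1 3))))
    (key h01 h12 (-2 * (M 0 3 * M 2 3)))) (key h02 h12 (-2 * (M 0 3 * M 1 3)))
  convert h using 1
  ring

/-- The determinant is arranged as g² + ℓh with ℓ = `M 0 1`, the shape required of a bitangent. -/
theorem det_of_diag_eq_zero {M : Matrix (Fin 4) (Fin 4) R} (hM : ∀ i j, M i j = M j i)
    (hd : ∀ i, M i i = 0) :
    M.det = (M 0 2 * M 1 3 - M 0 3 * M 1 2) ^ 2 + M 0 1 * (M 2 3 *
      (M 0 1 * M 2 3 - 2 * (M 0 2 * M 1 3 + M 0 3 * M 1 2))) := by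
  rw [symm_four_eta hM, det_symm_four, hd, hd, hd, hd]
  simp
  ring

end Determinants

/-! ### Singular points as membership in the square of a maximal ideal. -/

section Smooth

theorem eq_zero_of_mem_sq {D : MvPolynomial (Fin 3) ℂ} (hD : IsSmoothForm D) {p : Fin 3 → ℂ}
    (h : D ∈ RingHom.ker (eval p) ^ 2) : p = 0 := by
  have hp : eval p D = 0 ∧ ∀ t, eval p (pderiv t D) = 0 := by
    rw [pow_two] at h
    refine Submodule.mul_induction_on h ?_ ?_
    · intro a ha b hb
      rw [RingHom.mem_ker] at ha hb
      simp [ha, hb]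
    · intro a b ha hb
      refine ⟨by simp [ha.1, hb.1], fun t => by simp [ha.2 t, hb.2 t]⟩
  exact hD p hp.1 hp.2

theorem IsSmoothForm.C_mul {D : MvPolynomial (Fin 3) ℂ} (hD : IsSmoothForm D) {c : ℂ}
    (hc : c ≠ 0) : IsSmoothForm (C c * D) := by
  intro p h0 h1
  refine hD p ?_ fun t => ?_
  · simpa [hc] using h0
  · simpa [hc] using h1 t

end Smooth

/-- Two linear forms in three variables have a common nontrivial zero. -/
theorem exists_common_zero_of_two_forms {F : Type*} [Field F] (a b : Fin 3 → F) :
    ∃ p : Fin 3 → F, p ≠ 0 ∧ a ⬝ᵥ p = 0 ∧ b ⬝ᵥ p = 0 := by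
  have h : (Matrix.of ![a, b, 0]).det = 0 := Matrix.det_eq_zero_of_row_eq_zero 2 (by simp)
  obtain ⟨p, hp, h⟩ := Matrix.exists_mulVec_eq_zero_iff.mpr h
  exact ⟨p, hp, by simpa using congrFun h 0, by simpa using congrFun h 1⟩

/-! ### Transversality of a smooth net at its base points. -/

section Net

variable {A : Fin 3 → Matrix (Fin 4) (Fin 4) ℂ}

theorem linearMatrix_baseChange_symm (hA : ∀ t, (A t).IsSymm) (S : Matrix (Fin 4) (Fin 4) ℂ)
    (i j : Fin 4) : linearMatrix (baseChange A S) i j = linearMatrix (baseChange A S) j i := by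
  rw [linearMatrix_baseChange_apply, linearMatrix_baseChange_apply, polarVec_comm hA]

theorem isSmoothForm_det_baseChange (hD : IsSmoothForm (linearMatrix A).det)
    {S : Matrix (Fin 4) (Fin 4) ℂ} (hS : S.det ≠ 0) :
    IsSmoothForm (linearMatrix (baseChange A S)).det := by
  rw [det_linearMatrix_baseChange]
  exact hD.C_mul (pow_ne_zero 2 hS)

theorem exists_basis_of_ne_zero {u : Fin 4 → ℂ} (hu : u ≠ 0) :
    ∃ S : Matrix (Fin 4) (Fin 4) ℂ, S 0 = u ∧ S.det ≠ 0 := by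
  obtain ⟨k, hk⟩ := Function.ne_iff.mp hu
  -- A row of the identity is replaced by u at an index where u is nonzero, then moved to the top;
  -- the determinant is ± that entry.
  refine ⟨((1 : Matrix (Fin 4) (Fin 4) ℂ).updateRow k u).submatrix (Equiv.swap 0 k) id, ?_, ?_⟩
  · ext j
    simp
  · rw [Matrix.det_permute]
    have : ((1 : Matrix (Fin 4) (Fin 4) ℂ).updateRow k u).det = u k := by
      rw [← Matrix.det_transpose, ← Matrix.updateCol_transpose, Matrix.transpose_one,
        ← Matrix.cramer_apply, Matrix.cramer_one]
      rfl
    rw [this]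
    refine mul_ne_zero ?_ hk
    rcases Int.units_eq_one_or (Equiv.Perm.sign (Equiv.swap 0 k)) with h | h <;> simp [h]

/-- At an isotropic vector the net of quadrics is transversal. -/
theorem eq_zero_of_polarVec_dotProduct (hA : ∀ t, (A t).IsSymm)
    (hD : IsSmoothForm (linearMatrix A).det) {u : Fin 4 → ℂ} (hu : u ≠ 0)
    (hq : polarVec A u u = 0) {p : Fin 3 → ℂ} (hp : ∀ v, polarVec A u v ⬝ᵥ p = 0) : p = 0 := by
  obtain ⟨S, rfl, hS⟩ := exists_basis_of_ne_zero hu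
  refine eq_zero_of_mem_sq (isSmoothForm_det_baseChange hD hS)
    (det_mem_sq_of_row (linearMatrix_baseChange_symm hA S) ?_ fun j => ?_)
  · rw [linearMatrix_baseChange_apply, hq, linearForm_zero]
  · rw [RingHom.mem_ker, linearMatrix_baseChange_apply, eval_linearForm, hp]

/-- If v were independent of u, the polars of u would be spanned by those of two further basis
vectors, and two linear forms in three variables have a common zero, against transversality. -/
theorem exists_smul_of_polarVec_eq_zero (hA : ∀ t, (A t).IsSymm)
    (hD : IsSmoothForm (linearMatrix A).det) {u : Fin 4 → ℂ} (hu : u ≠ 0)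
    (hq : polarVec A u u = 0) {v : Fin 4 → ℂ} (hv : polarVec A u v = 0) : ∃ c : ℂ, v = c • u := by
  by_contra! hne
  have hli : LinearIndependent ℂ ![u, v] := by
    rw [LinearIndependent.pair_iff' hu]
    exact fun a h => hne a h.symm
  obtain ⟨w, hw⟩ := exists_linearIndependent_snoc_of_lt_finrank hli (by simp)
  obtain ⟨x, hx⟩ := exists_linearIndependent_snoc_of_lt_finrank hw (by simp)
  set b : Fin 4 → Fin 4 → ℂ := Fin.snoc (Fin.snoc ![u, v] w : Fin 3 → Fin 4 → ℂ) x with hb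
  have hspan := hx.span_eq_top_of_card_eq_finrank (by simp)
  obtain ⟨p, hp0, hp1, hp2⟩ :=
    exists_common_zero_of_two_forms (polarVec A u w) (polarVec A u x)
  refine hp0 (eq_zero_of_polarVec_dotProduct hA hD hu hq fun y => ?_)
  have hy : y ∈ Submodule.span ℂ (Set.range b) := hspan ▸ Submodule.mem_top
  obtain ⟨c, rfl⟩ := (Submodule.mem_span_range_iff_exists_fun ℂ).mp hy
  have h0 : b 0 = u := rfl
  have h1 : b 1 = v := rfl
  have h2 : b 2 = w := rfl
  have h3 : b 3 = x := rfl
  simp only [Fin.sum_univ_four, polarVec_add_right, polarVec_smul_right, h0, h1, h2, h3, hq, hv,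
    add_dotProduct, smul_dotProduct, hp1, hp2]
  simp

end Net

/-! ### General position of the octad, and its bitangents. -/

section Octad

variable {A : Fin 3 → Matrix (Fin 4) (Fin 4) ℂ} {O : Matrix (Fin 8) (Fin 4) ℂ}

theorem IsCayleyOctad.polarVec_self (hO : IsCayleyOctad A O) (i : Fin 8) :
    polarVec A (O i) (O i) = 0 :=
  funext fun t => ((hO.2.2 (O i) (hO.1 i)).mpr ⟨i, 1, (one_smul ℂ _).symm⟩) t

theorem IsCayleyOctad.exists_smul (hO : IsCayleyOctad A O) {u : Fin 4 → ℂ} (hu : u ≠ 0)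
    (hq : polarVec A u u = 0) : ∃ i, ∃ c : ℂ, u = c • O i :=
  (hO.2.2 u hu).mp (congrFun hq)

theorem IsCayleyOctad.polarVec_ne_zero (hA : ∀ t, (A t).IsSymm)
    (hD : IsSmoothForm (linearMatrix A).det) (hO : IsCayleyOctad A O) {i j : Fin 8} (hij : i ≠ j) :
    polarVec A (O i) (O j) ≠ 0 := by
  intro h
  obtain ⟨c, hc⟩ := exists_smul_of_polarVec_eq_zero hA hD (hO.1 i) (hO.polarVec_self i) h
  exact hij (hO.2.1 j i c hc).symm

theorem IsCayleyOctad.linearIndependent_three (hA : ∀ t, (A t).IsSymm)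
    (hD : IsSmoothForm (linearMatrix A).det) (hO : IsCayleyOctad A O) {i j k : Fin 8}
    (hij : i ≠ j) (hik : i ≠ k) (hjk : j ≠ k) : LinearIndependent ℂ ![O i, O j, O k] := by
  have key : ∀ {i j k : Fin 8}, i ≠ j → i ≠ k → j ≠ k → ∀ {a b c : ℂ},
      a • O i + b • O j + c • O k = 0 → c = 0 := by
    intro i j k hij hik hjk a b c h
    by_contra hc
    have hk : O k = (-a / c) • O i + (-b / c) • O j := by
      have : c • O k = (-a) • O i + (-b) • O j := by
        rw [← sub_eq_zero, ← h]; module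
      rw [← inv_smul_smul₀ hc (O k), this]
      module
    have h2 := hO.polarVec_self k
    rw [hk] at h2
    simp only [polarVec_add_left, polarVec_add_right, polarVec_smul_left, polarVec_smul_right,
      hO.polarVec_self, polarVec_comm hA (O j) (O i)] at h2
    -- On the line through two base points the net is a scalar multiple of the single vector b_ij.
    have h3 : (2 * (-a / c) * (-b / c)) • polarVec A (O i) (O j) = 0 := by
      rw [← h2]; module
    rcases smul_eq_zero.mp h3 with h4 | h4
    · simp only [mul_eq_zero, OfNat.ofNat_ne_zero, false_or] at h4
      rcases h4 with h4 | h4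
      · exact hjk (hO.2.1 k j (-b / c) (by rw [hk, h4]; simp)).symm
      · exact hik (hO.2.1 k i (-a / c) (by rw [hk, h4]; simp)).symm
    · exact hO.polarVec_ne_zero hA hD hij h4
  rw [Fintype.linearIndependent_iff]
  intro g hg
  replace hg : g 0 • O i + g 1 • O j + g 2 • O k = 0 := by
    rw [← hg, Fin.sum_univ_three]; rfl
  have h0 : g 0 = 0 := key hjk hij.symm hik.symm (a := g 1) (b := g 2) (by rw [← hg]; module)
  have h1 : g 1 = 0 := key hik hij hjk.symm (a := g 0) (b := g 2) (by rw [← hg]; module)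
  have h2 : g 2 = 0 := key hij hik hjk hg
  intro m
  fin_cases m
  exacts [h0, h1, h2]

/-- No four points of a Cayley octad of a smooth quartic are coplanar. -/
theorem IsCayleyOctad.coeff_eq_zero (hA : ∀ t, (A t).IsSymm)
    (hD : IsSmoothForm (linearMatrix A).det) (hO : IsCayleyOctad A O) {i j k l : Fin 8}
    (hij : i ≠ j) (hik : i ≠ k) (hjk : j ≠ k) (hil : i ≠ l) (hjl : j ≠ l) (hkl : k ≠ l)
    {a b c d : ℂ} (h : a • O i + b • O j + c • O k + d • O l = 0) : d = 0 := by
  by_contra hd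
  have hl : d • O l = (-a) • O i + (-b) • O j + (-c) • O k := by
    rw [← sub_eq_zero, ← h]; module
  have h2 : polarVec A (d • O l) (d • O l) = 0 := by
    rw [polarVec_smul_left, polarVec_smul_right, hO.polarVec_self]; simp
  rw [hl] at h2
  simp only [polarVec_add_left, polarVec_add_right, polarVec_smul_left, polarVec_smul_right,
    hO.polarVec_self, polarVec_comm hA (O j) (O i), polarVec_comm hA (O k) (O i),
    polarVec_comm hA (O k) (O j)] at h2
  have h3 : (a * b) • polarVec A (O i) (O j) + (a * c) • polarVec A (O i) (O k) +
      (b * c) • polarVec A (O j) (O k) = 0 := by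
    have : (2 : ℂ) • ((a * b) • polarVec A (O i) (O j) + (a * c) • polarVec A (O i) (O k) +
      (b * c) • polarVec A (O j) (O k)) = 0 := by rw [← h2]; module
    exact (smul_eq_zero.mp this).resolve_left two_ne_zero
  -- `h3` is a linear relation among the three forms, so they have a common zero: two forms always
  -- do, and the third follows when its coefficient is nonzero. If all three coefficients vanish,
  -- two of a, b, c are zero and O l coincides with another point.
  have hp : ∃ p : Fin 3 → ℂ, p ≠ 0 ∧ polarVec A (O i) (O j) ⬝ᵥ p = 0 ∧
      polarVec A (O i) (O k) ⬝ᵥ p = 0 ∧ polarVec A (O j) (O k) ⬝ᵥ p = 0 := by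
    by_cases hab : a * b = 0
    · by_cases hac : a * c = 0
      · by_cases hbc : b * c = 0
        · exfalso
          have hone : ∀ {m : Fin 8} {e : ℂ}, m ≠ l → d • O l = e • O m → False := by
            intro m e hm he
            exact hm (hO.2.1 l m (d⁻¹ * e) (by rw [mul_smul, ← he, inv_smul_smul₀ hd])).symm
          rcases mul_eq_zero.mp hab with ha | hb
          · rcases mul_eq_zero.mp hbc with hb | hc
            · exact hone hkl (e := -c) (by rw [hl, ha, hb]; simp)
            · exact hone hjl (e := -b) (by rw [hl, ha, hc]; simp)
          · rcases mul_eq_zero.mp hac with ha | hc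
            · exact hone hkl (e := -c) (by rw [hl, ha, hb]; simp)
            · exact hone hil (e := -a) (by rw [hl, hb, hc]; simp)
        · obtain ⟨p, h0, h1, h5⟩ := exists_common_zero_of_two_forms
            (polarVec A (O i) (O j)) (polarVec A (O i) (O k))
          refine ⟨p, h0, h1, h5, ?_⟩
          have := congrArg (· ⬝ᵥ p) h3
          simpa [add_dotProduct, h1, h5, mul_eq_zero.not.mp hbc, not_or.mp (mul_eq_zero.not.mp hbc)]
            using this
      · obtain ⟨p, h0, h1, h5⟩ := exists_common_zero_of_two_forms
            (polarVec A (O i) (O j)) (polarVec A (O j) (O k))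
        refine ⟨p, h0, h1, ?_, h5⟩
        have := congrArg (· ⬝ᵥ p) h3
        simpa [add_dotProduct, h1, h5, not_or.mp (mul_eq_zero.not.mp hac)] using this
    · obtain ⟨p, h0, h1, h5⟩ := exists_common_zero_of_two_forms
            (polarVec A (O i) (O k)) (polarVec A (O j) (O k))
      refine ⟨p, h0, ?_, h1, h5⟩
      have := congrArg (· ⬝ᵥ p) h3
      simpa [add_dotProduct, h1, h5, not_or.mp (mul_eq_zero.not.mp hab)] using this
  obtain ⟨p, hp0, hp1, hp2, hp3⟩ := hp
  obtain ⟨w, hw⟩ := exists_linearIndependent_snoc_of_lt_finrank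
    (hO.linearIndependent_three hA hD hij hik hjk) (by simp)
  set S : Matrix (Fin 4) (Fin 4) ℂ := Fin.snoc (![O i, O j, O k] : Fin 3 → Fin 4 → ℂ) w
  have hS : S.det ≠ 0 :=
    ((Matrix.isUnit_iff_isUnit_det S).mp (Matrix.linearIndependent_rows_iff_isUnit.mp hw)).ne_zero
  have s0 : S 0 = O i := rfl
  have s1 : S 1 = O j := rfl
  have s2 : S 2 = O k := rfl
  refine hp0 (eq_zero_of_mem_sq (isSmoothForm_det_baseChange hD hS)
    (det_mem_sq_of_block (linearMatrix_baseChange_symm hA S) ?_ ?_ ?_ ?_))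
  · intro m hm
    have : ∃ n, S m = O n := by
      fin_cases m
      exacts [⟨i, rfl⟩, ⟨j, rfl⟩, ⟨k, rfl⟩, absurd rfl hm]
    obtain ⟨n, hn⟩ := this
    rw [linearMatrix_baseChange_apply, hn, hO.polarVec_self, linearForm_zero]
  · rw [RingHom.mem_ker, linearMatrix_baseChange_apply, eval_linearForm, s0, s1, hp1]
  · rw [RingHom.mem_ker, linearMatrix_baseChange_apply, eval_linearForm, s0, s2, hp2]
  · rw [RingHom.mem_ker, linearMatrix_baseChange_apply, eval_linearForm, s1, s2, hp3]

theorem IsCayleyOctad.linearIndependent_four (hA : ∀ t, (A t).IsSymm)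
    (hD : IsSmoothForm (linearMatrix A).det) (hO : IsCayleyOctad A O) {s : Fin 4 → Fin 8}
    (hs : Function.Injective s) : LinearIndependent ℂ (fun k => O (s k)) := by
  rw [Fintype.linearIndependent_iff]
  intro g hg
  simp only [Fin.sum_univ_four] at hg
  have n {a b : Fin 4} (h : a ≠ b) : s a ≠ s b := hs.ne h
  have h0 : g 0 = 0 := hO.coeff_eq_zero hA hD (n (by decide : (1 : Fin 4) ≠ 2)) (n (by decide : (1 : Fin 4) ≠ 3))
      (n (by decide : (2 : Fin 4) ≠ 3)) (n (by decide : (1 : Fin 4) ≠ 0))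
      (n (by decide : (2 : Fin 4) ≠ 0)) (n (by decide : (3 : Fin 4) ≠ 0)) (a := g 1) (b := g 2)
      (c := g 3) (by rw [← hg]; module)
  have h1 : g 1 = 0 := hO.coeff_eq_zero hA hD (n (by decide : (0 : Fin 4) ≠ 2)) (n (by decide : (0 : Fin 4) ≠ 3))
      (n (by decide : (2 : Fin 4) ≠ 3)) (n (by decide : (0 : Fin 4) ≠ 1))
      (n (by decide : (2 : Fin 4) ≠ 1)) (n (by decide : (3 : Fin 4) ≠ 1)) (a := g 0) (b := g 2)
      (c := g 3) (by rw [← hg]; module)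
  have h2 : g 2 = 0 := hO.coeff_eq_zero hA hD (n (by decide : (0 : Fin 4) ≠ 1)) (n (by decide : (0 : Fin 4) ≠ 3))
      (n (by decide : (1 : Fin 4) ≠ 3)) (n (by decide : (0 : Fin 4) ≠ 2))
      (n (by decide : (1 : Fin 4) ≠ 2)) (n (by decide : (3 : Fin 4) ≠ 2)) (a := g 0) (b := g 1)
      (c := g 3) (by rw [← hg]; module)
  have h3 : g 3 = 0 := hO.coeff_eq_zero hA hD (n (by decide : (0 : Fin 4) ≠ 1)) (n (by decide : (0 : Fin 4) ≠ 2))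
      (n (by decide : (1 : Fin 4) ≠ 2)) (n (by decide : (0 : Fin 4) ≠ 3))
      (n (by decide : (1 : Fin 4) ≠ 3)) (n (by decide : (2 : Fin 4) ≠ 3)) (a := g 0) (b := g 1)
      (c := g 2) hg
  intro i
  fin_cases i
  exacts [h0, h1, h2, h3]

theorem IsCayleyOctad.det_submatrix_ne_zero (hA : ∀ t, (A t).IsSymm)
    (hD : IsSmoothForm (linearMatrix A).det) (hO : IsCayleyOctad A O) {s : Fin 4 → Fin 8}
    (hs : Function.Injective s) : (O.submatrix s id).det ≠ 0 :=
  ((Matrix.isUnit_iff_isUnit_det _).mp (Matrix.linearIndependent_rows_iff_isUnit.mp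
    (hO.linearIndependent_four hA hD hs))).ne_zero

/-- The determinant of the net as the determinant of the matrix of bitangents between four points
of the octad. -/
theorem IsCayleyOctad.det_eq (hA : ∀ t, (A t).IsSymm) (hO : IsCayleyOctad A O) (i j k l : Fin 8) :
    C ((O.submatrix ![i, j, k, l] id).det ^ 2) * (linearMatrix A).det =
      (linearForm (polarVec A (O i) (O k)) * linearForm (polarVec A (O j) (O l)) -
        linearForm (polarVec A (O i) (O l)) * linearForm (polarVec A (O j) (O k))) ^ 2 +
      linearForm (polarVec A (O i) (O j)) * (linearForm (polarVec A (O k) (O l)) *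
        (linearForm (polarVec A (O i) (O j)) * linearForm (polarVec A (O k) (O l)) -
        2 * (linearForm (polarVec A (O i) (O k)) * linearForm (polarVec A (O j) (O l)) +
          linearForm (polarVec A (O i) (O l)) * linearForm (polarVec A (O j) (O k))))) := by
  rw [← det_linearMatrix_baseChange, det_of_diag_eq_zero (linearMatrix_baseChange_symm hA _)]
  · simp only [linearMatrix_baseChange_apply]
    rfl
  · intro m
    rw [linearMatrix_baseChange_apply]
    have : (O.submatrix ![i, j, k, l] id) m = O (![i, j, k, l] m) := rfl
    rw [this, hO.polarVec_self, linearForm_zero]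

theorem IsCayleyOctad.isBitangent (hA : ∀ t, (A t).IsSymm)
    (hD : IsSmoothForm (linearMatrix A).det) (hO : IsCayleyOctad A O) {f : MvPolynomial (Fin 3) ℂ}
    {γ : ℂ} (hγ : γ ≠ 0) (hdet : (linearMatrix A).det = C γ * f) {i j : Fin 8} (hij : i ≠ j) :
    IsBitangent f (polarVec A (O i) (O j)) := by
  refine ⟨hO.polarVec_ne_zero hA hD hij, ?_⟩
  have hkl : ∃ k l : Fin 8, Function.Injective ![i, j, k, l] := by
    revert i j; decide
  obtain ⟨k, l, hinj⟩ := hkl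
  set δ := (O.submatrix ![i, j, k, l] id).det ^ 2 * γ with hδ
  have hδ0 : δ ≠ 0 := mul_ne_zero (pow_ne_zero 2 (hO.det_submatrix_ne_zero hA hD hinj)) hγ
  -- A square root of the inverse constant lets the scalar be absorbed into the square g².
  obtain ⟨e, he⟩ := IsAlgClosed.exists_pow_nat_eq δ⁻¹ (n := 2) (by norm_num)
  have h1 := hO.det_eq hA i j k l
  rw [hdet, ← mul_assoc, ← C_mul, ← hδ] at h1
  have hf : f = C e ^ 2 * (C δ * f) := by
    rw [← mul_assoc, ← C_pow, ← C_mul, he, inv_mul_cancel₀ hδ0, C_1, one_mul]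
  have L (u v : Fin 8) := linearForm_isHomogeneous (polarVec A (O u) (O v))
  refine ⟨C e * (linearForm (polarVec A (O i) (O k)) * linearForm (polarVec A (O j) (O l)) -
        linearForm (polarVec A (O i) (O l)) * linearForm (polarVec A (O j) (O k))),
      C (e ^ 2) * (linearForm (polarVec A (O k) (O l)) *
        (linearForm (polarVec A (O i) (O j)) * linearForm (polarVec A (O k) (O l)) -
        C 2 * (linearForm (polarVec A (O i) (O k)) * linearForm (polarVec A (O j) (O l)) +
          linearForm (polarVec A (O i) (O l)) * linearForm (polarVec A (O j) (O k))))), ?_, ?_, ?_⟩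
  · exact (((L i k).mul (L j l)).sub ((L i l).mul (L j k))).C_mul e
  · exact ((L k l).mul (((L i j).mul (L k l)).sub
      ((((L i k).mul (L j l)).add ((L i l).mul (L j k))).C_mul 2))).C_mul (e ^ 2)
  · rw [hf, h1]
    simp only [map_pow, map_ofNat]
    ring

end Octad

/-! ### Embeddings that move a transcendental element. -/

section Embeddings

theorem exists_ringHom_extending {R S M : Type*} [CommRing R] [IsDomain R] [Field S] [Field M]
    [Algebra R S] [Module.IsTorsionFree R S] [Algebra.IsAlgebraic R S] [IsAlgClosed M]
    (ψ : R →+* M) (hψ : Function.Injective ψ) : ∃ σ : S →+* M, ∀ r, σ (algebraMap R S r) = ψ r := by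
  let := ψ.toAlgebra
  have : FaithfulSMul R M := (faithfulSMul_iff_algebraMap_injective R M).mpr hψ
  let σ : S →ₐ[R] M := IsAlgClosed.lift
  exact ⟨σ, fun r => σ.commutes r⟩

theorem exists_algHom_ne_of_transcendental {K M : Type*} [Field K] [Field M] [IsAlgClosed M]
    [Algebra K M] {α : M} (hα : Transcendental K α) : ∃ σ : M →ₐ[K] M, σ α ≠ α := by
  have h1 : AlgebraicIndepOn K id ({α} : Set M) := by
    rw [AlgebraicIndepOn, algebraicIndependent_unique_type_iff]
    exact hα
  obtain ⟨t, hst, ht⟩ := exists_isTranscendenceBasis_superset h1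
  have := ht.isAlgebraic
  let e := ht.1.aevalEquiv
  -- Every element of a transcendence basis containing α is sent to its square. The map is injective
  -- and extends along the algebraic extension, and α² = α would make α algebraic.
  let ψ : Algebra.adjoin K (Set.range ((↑) : t → M)) →ₐ[K] M :=
    (aeval ((↑) : t → M)).comp ((expand 2).comp e.symm.toAlgHom)
  have hψ : Function.Injective ψ := by
    intro x y hxy
    have h2 := algebraicIndependent_iff_injective_aeval.mp ht.1 hxy
    exact e.symm.injective (expand_injective two_pos h2)
  obtain ⟨σ, hσ⟩ := exists_ringHom_extending (S := M) ψ.toRingHom hψ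
  refine ⟨{ σ with commutes' := fun r => ?_ }, ?_⟩
  · exact (hσ (algebraMap K _ r)).trans (ψ.commutes r)
  · have hαt : α ∈ t := hst rfl
    have heα : e (X ⟨α, hαt⟩) = ⟨α, Algebra.subset_adjoin ⟨⟨α, hαt⟩, rfl⟩⟩ := by
      apply Subtype.ext
      simp [e]
    have h2 : σ α = α ^ 2 := by
      have h3 := hσ (e (X ⟨α, hαt⟩))
      rw [heα] at h3
      refine h3.trans ?_
      rw [← heα]
      change aeval ((↑) : t → M) (expand 2 (e.symm (e (X ⟨α, hαt⟩)))) = α ^ 2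
      rw [AlgEquiv.symm_apply_apply, expand_X, map_pow, aeval_X]
    change σ α ≠ α
    rw [h2]
    intro h4
    have h5 : IsAlgebraic K α := by
      have h6 : α * (α - 1) = 0 := by linear_combination h4
      rcases mul_eq_zero.mp h6 with h | h
      · exact h ▸ isAlgebraic_zero
      · exact (sub_eq_zero.mp h) ▸ isAlgebraic_one
    exact hα h5

end Embeddings

/-! ### Different pairs of points give different bitangents. -/

section Distinct

variable {A : Fin 3 → Matrix (Fin 4) (Fin 4) ℂ} {O : Matrix (Fin 8) (Fin 4) ℂ}

theorem exists_common_zero_of_line_and_conic (l a b c d : Fin 3 → ℂ) :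
    ∃ p : Fin 3 → ℂ, p ≠ 0 ∧ l ⬝ᵥ p = 0 ∧ (a ⬝ᵥ p) * (b ⬝ᵥ p) = (c ⬝ᵥ p) * (d ⬝ᵥ p) := by
  obtain ⟨p, hp, hlp, -⟩ := exists_common_zero_of_two_forms l l
  by_cases hq : (a ⬝ᵥ p) * (b ⬝ᵥ p) = (c ⬝ᵥ p) * (d ⬝ᵥ p)
  · exact ⟨p, hp, hlp, hq⟩
  obtain ⟨t, ht⟩ := Function.ne_iff.mp hp
  -- A second point of the line, independent of p because its t-th coordinate vanishes. As the conic
  -- misses p, its restriction to s • p + q is truly quadratic in s.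
  obtain ⟨q, hq0, hlq, hqt⟩ := exists_common_zero_of_two_forms l (Pi.single t 1)
  have hqt : q t = 0 := by simpa using hqt
  have hdisc : ∀ z : ℂ, ∃ s, z = s * s := fun z => by
    obtain ⟨s, hs⟩ := IsAlgClosed.exists_pow_nat_eq z (n := 2) (by norm_num)
    exact ⟨s, by rw [← hs, sq]⟩
  obtain ⟨s, hs⟩ := exists_quadratic_eq_zero (sub_ne_zero.mpr hq)
    (b := (a ⬝ᵥ p) * (b ⬝ᵥ q) + (a ⬝ᵥ q) * (b ⬝ᵥ p) - (c ⬝ᵥ p) * (d ⬝ᵥ q) - (c ⬝ᵥ q) * (d ⬝ᵥ p))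
    (c := (a ⬝ᵥ q) * (b ⬝ᵥ q) - (c ⬝ᵥ q) * (d ⬝ᵥ q)) (hdisc _)
  refine ⟨s • p + q, fun h => hq0 ?_, ?_, ?_⟩
  · have hs0 : s = 0 := by
      have := congrFun h t
      simpa [hqt, show p t ≠ 0 from ht] using this
    simpa [hs0] using h
  · simp [dotProduct_add, hlp, hlq]
  · simp only [dotProduct_add, dotProduct_smul, smul_eq_mul]
    linear_combination hs

theorem IsCayleyOctad.polarVec_ne_smul_of_adjacent (hA : ∀ t, (A t).IsSymm)
    (hD : IsSmoothForm (linearMatrix A).det) (hO : IsCayleyOctad A O) {i j k : Fin 8}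
    (hij : i ≠ j) (hik : i ≠ k) (hjk : j ≠ k) (c : ℂ) :
    polarVec A (O i) (O j) ≠ c • polarVec A (O i) (O k) := by
  intro h
  have h1 : polarVec A (O i) (O j + (-c) • O k) = 0 := by
    rw [polarVec_add_right, polarVec_smul_right, h]; module
  obtain ⟨e, he⟩ := exists_smul_of_polarVec_eq_zero hA hD (hO.1 i) (hO.polarVec_self i) h1
  have h2 := Fintype.linearIndependent_iff.mp
    (hO.linearIndependent_three hA hD hij hik hjk) ![-e, 1, -c] (by
      simp only [Fin.sum_univ_three, Matrix.cons_val]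
      rw [add_assoc, one_smul, he]; module) 1
  simp at h2

/-- If b_ij = c b_kl, then the determinant is g² + b_kl² h up to a scalar, which is singular where
the line b_kl = 0 meets the conic g = 0. -/
theorem IsCayleyOctad.polarVec_ne_smul_of_disjoint (hA : ∀ t, (A t).IsSymm)
    (hD : IsSmoothForm (linearMatrix A).det) (hO : IsCayleyOctad A O) {i j k l : Fin 8}
    (hinj : Function.Injective ![i, j, k, l]) (c : ℂ) :
    polarVec A (O i) (O j) ≠ c • polarVec A (O k) (O l) := by
  intro h
  have hdet := hO.det_eq hA i j k l
  obtain ⟨p, hp, h1, h2⟩ := exists_common_zero_of_line_and_conic (polarVec A (O k) (O l))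
    (polarVec A (O i) (O k)) (polarVec A (O j) (O l)) (polarVec A (O i) (O l))
    (polarVec A (O j) (O k))
  refine hp (eq_zero_of_mem_sq (hD.C_mul
    (pow_ne_zero 2 (hO.det_submatrix_ne_zero hA hD hinj))) ?_)
  rw [hdet, h, linearForm_smul, smul_eq_C_mul]
  refine Ideal.add_mem _ (Ideal.pow_mem_pow ?_ 2) ?_
  · simp [RingHom.mem_ker, eval_linearForm, h2]
  · have h3 : linearForm (polarVec A (O k) (O l)) ^ 2 ∈ RingHom.ker (eval p) ^ 2 :=
      Ideal.pow_mem_pow (by rw [RingHom.mem_ker, eval_linearForm, h1]) 2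
    convert Ideal.mul_mem_right (C c * (C c * linearForm (polarVec A (O k) (O l)) *
      linearForm (polarVec A (O k) (O l)) -
        2 * (linearForm (polarVec A (O i) (O k)) * linearForm (polarVec A (O j) (O l)) +
          linearForm (polarVec A (O i) (O l)) * linearForm (polarVec A (O j) (O k))))) _ h3 using 1
    ring

/-- Different pairs of points of the octad give different bitangents. -/
theorem IsCayleyOctad.eq_or_eq_of_polarVec_eq_smul (hA : ∀ t, (A t).IsSymm)
    (hD : IsSmoothForm (linearMatrix A).det) (hO : IsCayleyOctad A O) {i j k l : Fin 8}
    (hij : i ≠ j) (hkl : k ≠ l) {c : ℂ}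
    (h : polarVec A (O i) (O j) = c • polarVec A (O k) (O l)) : k = i ∨ k = j := by
  by_contra! hne
  by_cases hli : l = i
  · rw [hli, polarVec_comm hA (O k)] at h
    exact hO.polarVec_ne_smul_of_adjacent hA hD hij hne.1.symm hne.2.symm c h
  by_cases hlj : l = j
  · rw [hlj, polarVec_comm hA (O k), polarVec_comm hA (O i)] at h
    exact hO.polarVec_ne_smul_of_adjacent hA hD hij.symm hne.2.symm hne.1.symm c h
  refine hO.polarVec_ne_smul_of_disjoint hA hD ?_ c h
  obtain ⟨h1, h2⟩ := hne
  clear h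
  revert i j k l
  decide

end Distinct

/-! ### Embeddings over K fix the octad. -/

section Rationality

theorem polarVec_map {F E : Type*} [Field F] [Field E] (φ : F →+* E)
    (A : Fin 3 → Matrix (Fin 4) (Fin 4) F) (u v : Fin 4 → F) :
    polarVec (fun t => (A t).map φ) (φ ∘ u) (φ ∘ v) = φ ∘ polarVec A u v := by
  ext t
  simp [polarVec, dotProduct, Matrix.mulVec]

/-- The field L is kept general because the result is used twice: with L = ℂ to prove algebraicity,
and with L the algebraic closure of K in ℂ for Galois descent. -/
theorem algHom_eq_of_octad {K L : Type*} [Field K] [Field L] [Algebra K L] [Algebra K ℂ]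
    [Algebra L ℂ] [IsScalarTower K L ℂ] (σ : L →ₐ[K] ℂ)
    (A : Fin 3 → Matrix (Fin 4) (Fin 4) K) (hA : ∀ t, (A t).IsSymm)
    (hD : IsSmoothForm (linearMatrix fun t => (A t).map (algebraMap K ℂ)).det)
    (N : Matrix (Fin 8) (Fin 4) L)
    (hN : IsCayleyOctad (fun t => (A t).map (algebraMap K ℂ)) (N.map (algebraMap L ℂ)))
    (hone : ∀ i, ∃ j, N i j = 1)
    (hrat : ∀ i j, i ≠ j → ∀ s t,
      polarVec (fun t => (A t).map (algebraMap K ℂ)) ((N.map (algebraMap L ℂ)) i)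
        ((N.map (algebraMap L ℂ)) j) t ≠ 0 →
      ∃ r : K, polarVec (fun t => (A t).map (algebraMap K ℂ)) ((N.map (algebraMap L ℂ)) i)
          ((N.map (algebraMap L ℂ)) j) s =
        algebraMap K ℂ r * polarVec (fun t => (A t).map (algebraMap K ℂ))
          ((N.map (algebraMap L ℂ)) i) ((N.map (algebraMap L ℂ)) j) t)
    (i : Fin 8) (j : Fin 4) : σ (N i j) = algebraMap L ℂ (N i j) := by
  set Aℂ : Fin 3 → Matrix (Fin 4) (Fin 4) ℂ := fun t => (A t).map (algebraMap K ℂ) with hAℂ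
  set AL : Fin 3 → Matrix (Fin 4) (Fin 4) L := fun t => (A t).map (algebraMap K L)
  set U := N.map (algebraMap L ℂ) with hU
  have hsym : ∀ t, (Aℂ t).IsSymm := fun t => (hA t).map _
  have hτ : Aℂ = fun t => (AL t).map (algebraMap L ℂ) := by
    ext t a b; simp [Aℂ, AL, ← IsScalarTower.algebraMap_apply]
  have hσ : Aℂ = fun t => (AL t).map (σ : L →+* ℂ) := by
    ext t a b; simp [Aℂ, AL]
  let b (i j : Fin 8) : Fin 3 → L := polarVec AL (N i) (N j)
  have bτ (i j : Fin 8) : polarVec Aℂ (U i) (U j) = algebraMap L ℂ ∘ b i j := by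
    rw [hτ]; exact polarVec_map (algebraMap L ℂ) AL (N i) (N j)
  have bσ (i j : Fin 8) : polarVec Aℂ (σ ∘ N i) (σ ∘ N j) = σ ∘ b i j := by
    rw [hσ]; exact polarVec_map (σ : L →+* ℂ) AL (N i) (N j)
  -- σ and the inclusion agree on the ratios of the coefficients of b_ij, which lie in K.
  have hprop (i j : Fin 8) (hij : i ≠ j) : ∃ c : ℂ, c ≠ 0 ∧ σ ∘ b i j = c • (algebraMap L ℂ ∘ b i j) := by
    have h0 := hN.polarVec_ne_zero hsym hD hij
    obtain ⟨t, ht⟩ := Function.ne_iff.mp h0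
    have hbt : b i j t ≠ 0 := by
      intro h; apply ht; rw [bτ]; simp [h]
    have hτt : algebraMap L ℂ (b i j t) ≠ 0 := by simpa using hbt
    refine ⟨σ (b i j t) / algebraMap L ℂ (b i j t), div_ne_zero (by simpa using hbt) hτt, ?_⟩
    ext s
    obtain ⟨r, hr⟩ := hrat i j hij s t ht
    rw [bτ, Function.comp_apply, Function.comp_apply, IsScalarTower.algebraMap_apply K L ℂ,
      ← map_mul] at hr
    have hr := (algebraMap L ℂ).injective hr
    simp only [Pi.smul_apply, Function.comp_apply, smul_eq_mul]
    rw [hr, map_mul, map_mul, AlgHom.commutes, ← IsScalarTower.algebraMap_apply]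
    field_simp
  have hne (i : Fin 8) : σ ∘ N i ≠ 0 := by
    obtain ⟨j, hj⟩ := hone i
    intro h
    have := congrFun h j
    simp [hj] at this
  -- The conjugate of an octad point is again a common zero of the net, hence some octad point.
  have hex (i : Fin 8) : ∃ k, ∃ c : ℂ, σ ∘ N i = c • U k := by
    refine hN.exists_smul (hne i) ?_
    have h1 : algebraMap L ℂ ∘ b i i = 0 := by rw [← bτ]; exact hN.polarVec_self i
    have h2 : b i i = 0 := by
      ext t
      have := congrFun h1 t
      simpa using this
    rw [bσ, h2]; ext; simp
  choose π c hπ using hex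
  have hc (i : Fin 8) : c i ≠ 0 := by
    intro h; apply hne i; rw [hπ, h, zero_smul]
  have hmain (i j : Fin 8) (hij : i ≠ j) : π i = i ∨ π i = j := by
    obtain ⟨e, he, h⟩ := hprop i j hij
    rw [← bσ, ← bτ, hπ i, hπ j, polarVec_smul_left, polarVec_smul_right, smul_smul] at h
    have hπij : π i ≠ π j := by
      intro h'
      rw [h', hN.polarVec_self, smul_zero, eq_comm, smul_eq_zero] at h
      exact h.elim he (hN.polarVec_ne_zero hsym hD hij)
    refine hN.eq_or_eq_of_polarVec_eq_smul hsym hD hij hπij (c := e⁻¹ * (c i * c j)) ?_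
    rw [mul_smul, h, inv_smul_smul₀ he]
  have hfix : π i = i := by
    -- Comparing i with two different partners leaves only π i = i.
    have hd : ∃ j k : Fin 8, i ≠ j ∧ i ≠ k ∧ j ≠ k := by
      clear * -; revert i; decide
    obtain ⟨j, k, hij, hik, hjk⟩ := hd
    rcases hmain i j hij with h | h
    · exact h
    · rcases hmain i k hik with h' | h'
      · exact h'
      · exact absurd (h.symm.trans h') hjk
  have hi := hπ i
  rw [hfix] at hi
  obtain ⟨k, hk⟩ := hone i
  -- The coordinate normalized to 1 turns projective equality into equality of vectors.
  have hci : c i = 1 := by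
    have := congrFun hi k
    simpa [hU, hk, eq_comm] using this
  have := congrFun hi j
  simpa [hci, hU] using this

end Rationality

/-! ### Descent of the octad to K. -/

section Rationality

theorem exists_eq_algebraMap_of_octad {K : Type*} [Field K] [CharZero K] [Algebra K ℂ]
    (A : Fin 3 → Matrix (Fin 4) (Fin 4) K) (hA : ∀ t, (A t).IsSymm)
    (hD : IsSmoothForm (linearMatrix fun t => (A t).map (algebraMap K ℂ)).det)
    (N : Matrix (Fin 8) (Fin 4) ℂ)
    (hN : IsCayleyOctad (fun t => (A t).map (algebraMap K ℂ)) N)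
    (hone : ∀ i, ∃ j, N i j = 1)
    (hrat : ∀ i j, i ≠ j → ∀ s t,
      polarVec (fun t => (A t).map (algebraMap K ℂ)) (N i) (N j) t ≠ 0 →
      ∃ r : K, polarVec (fun t => (A t).map (algebraMap K ℂ)) (N i) (N j) s =
        algebraMap K ℂ r * polarVec (fun t => (A t).map (algebraMap K ℂ)) (N i) (N j) t)
    (i : Fin 8) (j : Fin 4) : ∃ r : K, algebraMap K ℂ r = N i j := by
  have halg (i : Fin 8) (j : Fin 4) : IsAlgebraic K (N i j) := by
    by_contra h
    obtain ⟨σ, hσ⟩ := exists_algHom_ne_of_transcendental h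
    have hid : N.map (algebraMap ℂ ℂ) = N := by ext; simp
    exact hσ (algHom_eq_of_octad σ A hA hD N (by rwa [hid]) hone (by rwa [hid]) i j)
  let L := algebraicClosure K ℂ
  let N' : Matrix (Fin 8) (Fin 4) L :=
    Matrix.of fun i j => ⟨N i j, mem_algebraicClosure_iff.mpr (halg i j)⟩
  have hN' : N'.map (algebraMap L ℂ) = N := by ext; rfl
  have hone' (i : Fin 8) : ∃ j, N' i j = 1 := by
    obtain ⟨j, hj⟩ := hone i
    exact ⟨j, Subtype.ext hj⟩
  have hfix : N' i j ∈ Set.range (algebraMap K L) := by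
    rw [InfiniteGalois.mem_range_algebraMap_iff_fixed]
    intro σ
    exact (algebraMap L ℂ).injective (algHom_eq_of_octad
      ((IsScalarTower.toAlgHom K L ℂ).comp σ.toAlgHom) A hA hD N' (by rwa [hN']) hone'
      (by rwa [hN']) i j)
  obtain ⟨r, hr⟩ := hfix
  exact ⟨r, by rw [IsScalarTower.algebraMap_apply K L ℂ, hr]; rfl⟩

theorem IsCayleyOctad.of_samePoints {A : Fin 3 → Matrix (Fin 4) (Fin 4) ℂ}
    {O O' : Matrix (Fin 8) (Fin 4) ℂ} (hO : IsCayleyOctad A O) (h : SamePoints O' O) :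
    IsCayleyOctad A O' := by
  choose c hc h using h
  have h' (i) : O i = (c i)⁻¹ • O' i := by rw [h, inv_smul_smul₀ (hc i)]
  refine ⟨fun i => ?_, fun i j e hij => ?_, fun u hu => ?_⟩
  · rw [h]; exact smul_ne_zero (hc i) (hO.1 i)
  · refine hO.2.1 i j ((c i)⁻¹ * e * c j) ?_
    rw [h' i, hij, h j, smul_smul, smul_smul]
  · rw [hO.2.2 u hu]
    constructor
    · rintro ⟨i, e, rfl⟩
      exact ⟨i, e * (c i)⁻¹, by rw [h', smul_smul]⟩
    · rintro ⟨i, e, rfl⟩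
      exact ⟨i, e * c i, by rw [h, smul_smul]⟩

theorem SamePoints.symm {F : Type*} [Field F] {O O' : Matrix (Fin 8) (Fin 4) F}
    (h : SamePoints O O') : SamePoints O' O := by
  intro i
  obtain ⟨c, hc, hi⟩ := h i
  exact ⟨c⁻¹, inv_ne_zero hc, by rw [hi, inv_smul_smul₀ hc]⟩

theorem exists_rational_octad {f : MvPolynomial (Fin 3) ℂ} {K : IntermediateField ℚ ℂ}
    (hK : bitangentField f ≤ K) {A : Fin 3 → Matrix (Fin 4) (Fin 4) K}
    (hA : ∀ t, (A t).IsSymm) {γ : ℂ} (hγ : γ ≠ 0)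
    (hD : IsSmoothForm (linearMatrix fun t => toComplex (A t)).det)
    (hdet : (linearMatrix fun t => toComplex (A t)).det = C γ * f)
    {P : Matrix (Fin 8) (Fin 4) ℂ} (hP : IsCayleyOctad (fun t => toComplex (A t)) P) :
    ∃ Q : Matrix (Fin 8) (Fin 4) K, SamePoints (toComplex Q) P := by
  have hAc (t) : (toComplex (A t)).IsSymm := (hA t).map _
  have hcoord (i : Fin 8) : ∃ j, P i j ≠ 0 := Function.ne_iff.mp (hP.1 i)
  choose k hk using hcoord
  let N : Matrix (Fin 8) (Fin 4) ℂ := fun i => (P i (k i))⁻¹ • P i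
  have hNP : SamePoints N P := fun i => ⟨(P i (k i))⁻¹, inv_ne_zero (hk i), rfl⟩
  have hN := hP.of_samePoints hNP
  have hr : ∀ i j, ∃ r : K, algebraMap K ℂ r = N i j := by
    refine exists_eq_algebraMap_of_octad A hA hD N hN
      (fun i => ⟨k i, inv_mul_cancel₀ (hk i)⟩) fun i j hij s t ht => ?_
    -- Since b_ij is a bitangent, the ratios of its coefficients are generators of the bitangent
    -- field.
    have hb := hN.isBitangent hAc hD hγ hdet hij
    refine ⟨⟨_, hK (IntermediateField.subset_adjoin ℚ _ ⟨_, hb, s, t, ht, rfl⟩)⟩, ?_⟩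
    exact (div_mul_cancel₀ _ ht).symm
  choose Q hQ using hr
  have : toComplex (Matrix.of Q) = N := by ext i j; exact hQ i j
  exact ⟨Matrix.of Q, this ▸ hNP⟩

end Rationality

/-! ### Coordinates in which the first four points are the basis vectors. -/

section Normalized

theorem IsCayleyOctad.baseChange {A : Fin 3 → Matrix (Fin 4) (Fin 4) ℂ}
    {O : Matrix (Fin 8) (Fin 4) ℂ} (hO : IsCayleyOctad A O) {S : Matrix (Fin 4) (Fin 4) ℂ}
    (hS : IsUnit S.det) : IsCayleyOctad (_root_.baseChange A S) (O * S⁻¹) := by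
  have hrow (i) : (O * S⁻¹) i = Matrix.vecMul (O i) S⁻¹ := Matrix.mul_apply_eq_vecMul _ _ _
  have hinv (i) : O i = Matrix.vecMul ((O * S⁻¹) i) S := by
    rw [hrow, Matrix.vecMul_vecMul, Matrix.nonsing_inv_mul S hS, Matrix.vecMul_one]
  have hcancel (u : Fin 4 → ℂ) : Matrix.vecMul (Matrix.vecMul u S) S⁻¹ = u := by
    rw [Matrix.vecMul_vecMul, Matrix.mul_nonsing_inv S hS, Matrix.vecMul_one]
  refine ⟨fun i h => hO.1 i ?_, fun i j c h => hO.2.1 i j c ?_, fun u hu => ?_⟩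
  · rw [hinv, h, Matrix.zero_vecMul]
  · rw [hinv i, h, Matrix.smul_vecMul, ← hinv]
  · have hu' : Matrix.vecMul u S ≠ 0 := fun h => hu (by rw [← hcancel u, h, Matrix.zero_vecMul])
    have h1 := hO.2.2 _ hu'
    have h2 (t) : u ⬝ᵥ (_root_.baseChange A S t).mulVec u =
        Matrix.vecMul u S ⬝ᵥ (A t).mulVec (Matrix.vecMul u S) :=
      congrFun (polarVec_baseChange A S u u) t
    simp only [h2]
    rw [h1]
    constructor
    · rintro ⟨i, c, h⟩
      exact ⟨i, c, by rw [← hcancel u, h, Matrix.smul_vecMul, hrow]⟩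
    · rintro ⟨i, c, h⟩
      exact ⟨i, c, by rw [h, Matrix.smul_vecMul, ← hinv]⟩

variable {F : Type*} [Field F]

theorem principalBlock_eq_baseChange (A : Fin 3 → Matrix (Fin 4) (Fin 4) F)
    (Q : Matrix (Fin 8) (Fin 4) F) :
    principalBlock A Q = baseChange A (Q.submatrix firstFour id) := by
  ext t i j
  change (Q * A t * Q.transpose) (firstFour i) (firstFour j) =
    (Q.submatrix firstFour id * A t * (Q.submatrix firstFour id).transpose) i j
  rw [mul_mul_transpose_apply, mul_mul_transpose_apply]
  rfl

theorem polarVec_normalizedOctad (A : Fin 3 → Matrix (Fin 4) (Fin 4) F)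
    {Q : Matrix (Fin 8) (Fin 4) F} (hQ : IsUnit (Q.submatrix firstFour id).det) (i j : Fin 8) :
    polarVec (principalBlock A Q) (normalizedOctad Q i) (normalizedOctad Q j) =
      polarVec A (Q i) (Q j) := by
  have h (i) : Matrix.vecMul (normalizedOctad Q i) (Q.submatrix firstFour id) = Q i := by
    rw [normalizedOctad, Matrix.mul_apply_eq_vecMul, Matrix.vecMul_vecMul,
      Matrix.nonsing_inv_mul _ hQ, Matrix.vecMul_one]
  rw [principalBlock_eq_baseChange, polarVec_baseChange, h, h]

theorem normalizedOctad_firstFour {Q : Matrix (Fin 8) (Fin 4) F}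
    (hQ : IsUnit (Q.submatrix firstFour id).det) (k : Fin 4) :
    normalizedOctad Q (firstFour k) = Pi.single k 1 := by
  have h : (normalizedOctad Q).submatrix firstFour id = 1 := by
    rw [normalizedOctad, ← Matrix.mul_nonsing_inv _ hQ]
    rfl
  ext j
  have := congrFun (congrFun h k) j
  simpa [Matrix.one_apply, Pi.single_apply, eq_comm] using this

theorem firstFour_injective : Function.Injective firstFour := Fin.castLE_injective _

end Normalized

/-! ### The bifid substitution and coordinate inversion. -/

section Bifid

/-- With zero diagonal the determinant depends only on the products M₀₁M₂₃, M₀₂M₁₃ and M₀₃M₁₂, and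
the substitution merely swaps the factors of each. -/
theorem det_bifidMatrix {R : Type*} [CommRing R] {M : Matrix (Fin 4) (Fin 4) R}
    (hM : ∀ i j, M i j = M j i) (hd : ∀ i, M i i = 0) : (bifidMatrix M).det = M.det := by
  rw [symm_four_eta hM, bifidMatrix, det_symm_four, det_symm_four, hd, hd, hd, hd]
  simp
  ring

theorem linearMatrix_bifidMatrix {F : Type*} [Field F] (G : Fin 3 → Matrix (Fin 4) (Fin 4) F) :
    linearMatrix (fun t => bifidMatrix (G t)) = bifidMatrix (linearMatrix G) := by
  ext1 i j
  fin_cases i <;> fin_cases j <;> simp [linearMatrix, bifidMatrix, linearForm]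

theorem bifidMatrix_isSymm {R : Type*} [Zero R] (N : Matrix (Fin 4) (Fin 4) R) :
    (bifidMatrix N).IsSymm := by
  ext i j
  fin_cases i <;> fin_cases j <;> rfl

theorem bifidMatrix_apply_of_ne {R : Type*} [Zero R] {N : Matrix (Fin 4) (Fin 4) R}
    (hN : ∀ i j, N i j = N j i) {i j k l : Fin 4} (hij : i ≠ j) (hik : i ≠ k) (hil : i ≠ l)
    (hjk : j ≠ k) (hjl : j ≠ l) (hkl : k ≠ l) : bifidMatrix N i j = N k l := by
  fin_cases i <;> fin_cases j <;> first | exact absurd rfl hij | skip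
  all_goals
    fin_cases k <;> first | exact absurd rfl hik | exact absurd rfl hjk | skip
  all_goals
    fin_cases l <;> first | exact absurd rfl hil | exact absurd rfl hjl | exact absurd rfl hkl | skip
  all_goals first | rfl | exact hN _ _

variable {F : Type*} [Field F]

theorem dotProduct_mulVec_of_diag {N : Matrix (Fin 4) (Fin 4) F} (hN : ∀ i j, N i j = N j i)
    (hd : ∀ i, N i i = 0) (u v : Fin 4 → F) :
    u ⬝ᵥ N.mulVec v = N 0 1 * (u 0 * v 1 + u 1 * v 0) + N 0 2 * (u 0 * v 2 + u 2 * v 0) +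
      N 0 3 * (u 0 * v 3 + u 3 * v 0) + N 1 2 * (u 1 * v 2 + u 2 * v 1) +
      N 1 3 * (u 1 * v 3 + u 3 * v 1) + N 2 3 * (u 2 * v 3 + u 3 * v 2) := by
  simp only [dotProduct, Matrix.mulVec, Fin.sum_univ_four, hd, hN 1 0, hN 2 0, hN 3 0, hN 2 1,
    hN 3 1, hN 3 2]
  ring

theorem dotProduct_bifidMatrix_mulVec (N : Matrix (Fin 4) (Fin 4) F) (u v : Fin 4 → F) :
    u ⬝ᵥ (bifidMatrix N).mulVec v =
      N 2 3 * (u 0 * v 1 + u 1 * v 0) + N 1 3 * (u 0 * v 2 + u 2 * v 0) +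
      N 1 2 * (u 0 * v 3 + u 3 * v 0) + N 0 3 * (u 1 * v 2 + u 2 * v 1) +
      N 0 2 * (u 1 * v 3 + u 3 * v 1) + N 0 1 * (u 2 * v 3 + u 3 * v 2) := by
  rw [dotProduct_mulVec_of_diag (fun i j => (bifidMatrix_isSymm N).apply j i)
    (fun i => by fin_cases i <;> rfl)]
  rfl

/-- The Cremona transformation turns the quadric `N` into its bifid substitution. -/
theorem bifidMatrix_inv_inv {N : Matrix (Fin 4) (Fin 4) F} (hN : ∀ i j, N i j = N j i)
    (hd : ∀ i, N i i = 0) {w : Fin 4 → F} (hw : ∀ j, w j ≠ 0) :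
    w⁻¹ ⬝ᵥ (bifidMatrix N).mulVec w⁻¹ = (w 0 * w 1 * w 2 * w 3)⁻¹ * (w ⬝ᵥ N.mulVec w) := by
  rw [dotProduct_bifidMatrix_mulVec, dotProduct_mulVec_of_diag hN hd]
  have h0 := hw 0
  have h1 := hw 1
  have h2 := hw 2
  have h3 := hw 3
  simp only [Pi.inv_apply]
  field_simp
  ring

/-- This is the derivative of the identity `bifidMatrix_inv_inv` in the k-th coordinate, taken at a
zero w of the quadric; the factor -w_k² comes from differentiating 1/w_k. -/
theorem bifidMatrix_single_inv [NeZero (2 : F)] {N : Matrix (Fin 4) (Fin 4) F}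
    (hN : ∀ i j, N i j = N j i)
    (hd : ∀ i, N i i = 0) {w : Fin 4 → F} (hw : ∀ j, w j ≠ 0) (hq : w ⬝ᵥ N.mulVec w = 0)
    (k : Fin 4) :
    (Pi.single k 1 : Fin 4 → F) ⬝ᵥ (bifidMatrix N).mulVec w⁻¹ =
      -(w k ^ 2 * (w 0 * w 1 * w 2 * w 3)⁻¹) * ((Pi.single k 1 : Fin 4 → F) ⬝ᵥ N.mulVec w) := by
  rw [dotProduct_mulVec_of_diag hN hd] at hq
  have h2 : 2 * (N 0 1 * (w 0 * w 1) + N 0 2 * (w 0 * w 2) + N 0 3 * (w 0 * w 3) +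
      N 1 2 * (w 1 * w 2) + N 1 3 * (w 1 * w 3) + N 2 3 * (w 2 * w 3)) = 0 := by
    linear_combination hq
  replace hq := (mul_eq_zero.mp h2).resolve_left two_ne_zero
  rw [dotProduct_bifidMatrix_mulVec, dotProduct_mulVec_of_diag hN hd]
  have h0 := hw 0
  have h1 := hw 1
  have h2 := hw 2
  have h3 := hw 3
  fin_cases k <;> simp <;> field_simp <;> linear_combination hq

end Bifid

/-! ### The Cremona image of the octad. -/

section Cremona

theorem cremonaOctad_of_lt {F : Type*} [Field F] (O : Matrix (Fin 8) (Fin 4) F) {i : Fin 8}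
    (hi : i.val < 4) : cremonaOctad O i = O i := by
  ext j; simp [cremonaOctad, hi]

theorem cremonaOctad_of_le {F : Type*} [Field F] (O : Matrix (Fin 8) (Fin 4) F) {i : Fin 8}
    (hi : 4 ≤ i.val) : cremonaOctad O i = (O i)⁻¹ := by
  ext j; simp [cremonaOctad, hi]

theorem exists_firstFour_eq {i : Fin 8} (hi : i.val < 4) : ∃ k, firstFour k = i :=
  ⟨⟨i, hi⟩, rfl⟩

theorem injective_update_firstFour (k : Fin 4) {i : Fin 8} (hi : 4 ≤ i.val) :
    Function.Injective (Function.update firstFour k i) := by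
  intro a b h
  have hlt (a : Fin 4) : firstFour a ≠ i := fun h => by
    have : (firstFour a).val < 4 := a.isLt
    rw [h] at this
    omega
  by_cases ha : a = k <;> by_cases hb : b = k
  · rw [ha, hb]
  · subst ha; simp [Function.update_of_ne hb] at h; exact absurd h.symm (hlt b)
  · subst hb; simp [Function.update_of_ne ha] at h; exact absurd h (hlt a)
  · rw [Function.update_of_ne ha, Function.update_of_ne hb] at h
    exact firstFour_injective h

variable {G : Fin 3 → Matrix (Fin 4) (Fin 4) ℂ} {O : Matrix (Fin 8) (Fin 4) ℂ}

theorem IsCayleyOctad.diag_eq_zero (hO : IsCayleyOctad G O)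
    (hbase : ∀ k, O (firstFour k) = Pi.single k 1) (t : Fin 3) (k : Fin 4) : G t k k = 0 := by
  have := congrFun (hO.polarVec_self (firstFour k)) t
  simpa [hbase, polarVec] using this

theorem IsCayleyOctad.entry_ne_zero (hG : ∀ t, (G t).IsSymm)
    (hD : IsSmoothForm (linearMatrix G).det) (hO : IsCayleyOctad G O)
    (hbase : ∀ k, O (firstFour k) = Pi.single k 1) {i : Fin 8} (hi : 4 ≤ i.val) (j : Fin 4) :
    O i j ≠ 0 := by
  intro h
  have h1 := Fintype.linearIndependent_iff.mp
    (hO.linearIndependent_four hG hD (injective_update_firstFour j hi))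
    (Function.update (O i) j (-1)) (by
      ext m
      simp only [Finset.sum_apply, Pi.smul_apply, smul_eq_mul, Pi.zero_apply]
      rw [Finset.sum_eq_add_sum_sdiff_singleton_of_mem (Finset.mem_univ j)]
      have hsum : ∀ k ∈ Finset.univ \ {j}, Function.update (O i) j (-1) k *
          O (Function.update firstFour j i k) m = O i k * (if k = m then 1 else 0) := by
        intro k hk
        have hkj : k ≠ j := by simpa using hk
        rw [Function.update_of_ne hkj, Function.update_of_ne hkj, hbase, Pi.single_apply]
        simp [eq_comm]
      rw [Finset.sum_congr rfl hsum]
      by_cases hm : m = j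
      · subst hm; simp [h]
      · simp [hm]) j
  simp at h1

/-- The points O i, O i' and the two basis vectors other than e_j, e_j' are not coplanar. These
minors make the denominators of `cubicCoeff` nonzero. -/
theorem IsCayleyOctad.minor_ne_zero (hG : ∀ t, (G t).IsSymm)
    (hD : IsSmoothForm (linearMatrix G).det) (hO : IsCayleyOctad G O)
    (hbase : ∀ k, O (firstFour k) = Pi.single k 1) {i i' : Fin 8} (hi : 4 ≤ i.val)
    (hi' : 4 ≤ i'.val) (hii : i ≠ i') {j j' : Fin 4} (hjj : j ≠ j') :
    O i j * O i' j' - O i j' * O i' j ≠ 0 := by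
  intro h
  have hinj : Function.Injective (Function.update (Function.update firstFour j i) j' i') := by
    intro a b hab
    have hlt (a : Fin 4) : (firstFour a).val < 4 := a.isLt
    simp only [Function.update_apply] at hab
    split_ifs at hab with h1 h2 h3 h4 h5 h6 h7 h8
    all_goals first
      | exact firstFour_injective hab
      | (subst_vars; rfl)
      | (exfalso; have := congrArg Fin.val hab; have := hlt a; have := hlt b; omega)
  have h1 := Fintype.linearIndependent_iff.mp (hO.linearIndependent_four hG hD hinj)
    -- The coefficients express that O i' j • O i - O i j • O i' has zero j-th and, by `h`, zero
    -- j'-th coordinate, so the other two basis vectors span it.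
    (Function.update (Function.update (fun k => O i' j * O i k - O i j * O i' k) j (-O i' j))
      j' (O i j)) (by
      ext m
      have key : ∀ k, Function.update (Function.update
          (fun k => O i' j * O i k - O i j * O i' k) j (-O i' j)) j' (O i j) k *
          O (Function.update (Function.update firstFour j i) j' i' k) m =
          (if k = m then O i' j * O i k - O i j * O i' k else 0) +
          (if k = j then -O i' j * O i m else 0) + (if k = j' then O i j * O i' m else 0) := by
        intro k
        simp only [Function.update_apply]
        split_ifs with h1 h2 h3 h4 h5 h6
        all_goals first
          | (subst_vars; first | contradiction | linear_combination h | ring1)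
          | (rw [hbase, Pi.single_apply]; simp_all [eq_comm])
      simp only [Finset.sum_apply, Pi.smul_apply, smul_eq_mul, Pi.zero_apply, key,
        Finset.sum_add_distrib, Finset.sum_ite_eq', Finset.mem_univ, if_true]
      ring) j'
  rw [Function.update_self] at h1
  exact hO.entry_ne_zero hG hD hbase hi j h1

theorem IsCayleyOctad.eq_zero_of_row (hG : ∀ t, (G t).IsSymm)
    (hD : IsSmoothForm (linearMatrix G).det) (hO : IsCayleyOctad G O)
    (hbase : ∀ k, O (firstFour k) = Pi.single k 1) {k : Fin 4} {v : Fin 4 → ℂ}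
    (hv : ∀ t, (G t).mulVec v k = 0) {j : Fin 4} (hj : j ≠ k) : v j = 0 := by
  obtain ⟨c, rfl⟩ := exists_smul_of_polarVec_eq_zero hG hD (hO.1 (firstFour k))
    (hO.polarVec_self _) (v := v) (by
      ext t
      simpa [polarVec, hbase] using hv t)
  simp [hbase, hj]

/-- A zero of the transformed net on a coordinate plane is a coordinate point. -/
theorem IsCayleyOctad.exists_smul_single (hG : ∀ t, (G t).IsSymm)
    (hD : IsSmoothForm (linearMatrix G).det) (hO : IsCayleyOctad G O)
    (hbase : ∀ k, O (firstFour k) = Pi.single k 1) {u : Fin 4 → ℂ}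
    (hq : ∀ t, u ⬝ᵥ (bifidMatrix (G t)).mulVec u = 0) {k : Fin 4} (hk : u k = 0) :
    ∃ j, ∃ c : ℂ, u = c • (Pi.single j 1 : Fin 4 → ℂ) := by
  have hsym (t i j) : G t i j = G t j i := (hG t).apply j i
  have hd := hO.diag_eq_zero hbase
  simp only [dotProduct_bifidMatrix_mulVec] at hq
  -- On u_k = 0 the transformed quadric is twice row k of `G t` applied to the vector v whose l-th
  -- entry is the product of the two coordinates other than u_k and u_l. So v is polar to e_k, hence
  -- a multiple of it, and the products vanish.
  have hprod : ∀ i j, i ≠ j → u i * u j = 0 := by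
    have key (v : Fin 4 → ℂ) (hv : ∀ t, 2 * (G t).mulVec v k = 0) (j : Fin 4) (hj : j ≠ k) :
        v j = 0 :=
      hO.eq_zero_of_row hG hD hbase (fun t => (mul_eq_zero.mp (hv t)).resolve_left two_ne_zero) hj
    have hpairs : u 0 * u 1 = 0 ∧ u 0 * u 2 = 0 ∧ u 0 * u 3 = 0 ∧ u 1 * u 2 = 0 ∧ u 1 * u 3 = 0 ∧
        u 2 * u 3 = 0 := by
      have hk' := hk
      obtain rfl | rfl | rfl | rfl : k = 0 ∨ k = 1 ∨ k = 2 ∨ k = 3 := by omega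
      · have h := key ![0, u 2 * u 3, u 1 * u 3, u 1 * u 2] fun t => by
          simp only [Matrix.mulVec, dotProduct, Fin.sum_univ_four, Matrix.cons_val]
          have := hq t
          rw [hk'] at this
          linear_combination this
        exact ⟨by simp [hk'], by simp [hk'], by simp [hk'], h 3 (by decide),
          h 2 (by decide), h 1 (by decide)⟩
      · have h := key ![u 2 * u 3, 0, u 0 * u 3, u 0 * u 2] fun t => by
          simp only [Matrix.mulVec, dotProduct, Fin.sum_univ_four, Matrix.cons_val]
          have := hq t
          rw [hk'] at this
          linear_combination this + 2 * u 2 * u 3 * hsym t 1 0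
        exact ⟨by simp [hk'], h 3 (by decide), h 2 (by decide), by simp [hk'],
          by simp [hk'], h 0 (by decide)⟩
      · have h := key ![u 1 * u 3, u 0 * u 3, 0, u 0 * u 1] fun t => by
          simp only [Matrix.mulVec, dotProduct, Fin.sum_univ_four, Matrix.cons_val]
          have := hq t
          rw [hk'] at this
          linear_combination this + 2 * u 1 * u 3 * hsym t 2 0 + 2 * u 0 * u 3 * hsym t 2 1
        exact ⟨h 3 (by decide), by simp [hk'], h 1 (by decide), by simp [hk'],
          h 0 (by decide), by simp [hk']⟩
      · have h := key ![u 1 * u 2, u 0 * u 2, u 0 * u 1, 0] fun t => by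
          simp only [Matrix.mulVec, dotProduct, Fin.sum_univ_four, Matrix.cons_val]
          have := hq t
          rw [hk'] at this
          linear_combination this + 2 * u 1 * u 2 * hsym t 3 0 + 2 * u 0 * u 2 * hsym t 3 1 +
            2 * u 0 * u 1 * hsym t 3 2
        exact ⟨h 2 (by decide), h 1 (by decide), by simp [hk'],
          h 0 (by decide), by simp [hk'], by simp [hk']⟩
    obtain ⟨h01, h02, h03, h12, h13, h23⟩ := hpairs
    intro i j hij
    fin_cases i <;> fin_cases j <;>
      first | exact absurd rfl hij | assumption | (rw [mul_comm]; assumption)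
  by_cases hu : u = 0
  · exact ⟨0, 0, by rw [hu, zero_smul]⟩
  obtain ⟨j, hj⟩ := Function.ne_iff.mp hu
  refine ⟨j, u j, ?_⟩
  ext i
  by_cases hij : i = j
  · subst hij; simp
  · simpa [hij] using (mul_eq_zero.mp (hprod i j hij)).resolve_right hj

/-- Off the coordinate planes inversion exchanges the zeros of the two nets; on them
`exists_smul_single` leaves only the coordinate points. The other four points have no zero
coordinate, so the two kinds never coincide. -/
theorem IsCayleyOctad.cremonaOctad (hG : ∀ t, (G t).IsSymm)
    (hD : IsSmoothForm (linearMatrix G).det) (hO : IsCayleyOctad G O)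
    (hbase : ∀ k, O (firstFour k) = Pi.single k 1) :
    IsCayleyOctad (fun t => bifidMatrix (G t)) (_root_.cremonaOctad O) := by
  have hsym (t i j) : G t i j = G t j i := (hG t).apply j i
  have hd := hO.diag_eq_zero hbase
  have hne := fun {i} hi j => hO.entry_ne_zero hG hD hbase (i := i) hi j
  have hcne : ∀ {i : Fin 8}, 4 ≤ i.val → ∀ j, _root_.cremonaOctad O i j ≠ 0 := fun hi j => by
    rw [cremonaOctad_of_le O hi]; exact inv_ne_zero (hne hi j)
  have hz : ∀ {i : Fin 8}, i.val < 4 → ∃ j, _root_.cremonaOctad O i j = 0 := fun {i} hi => by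
    obtain ⟨k, rfl⟩ := exists_firstFour_eq hi
    rw [cremonaOctad_of_lt O hi, hbase]
    exact ⟨k + 1, by simp⟩
  have h0 : ∀ i, _root_.cremonaOctad O i ≠ 0 := by
    intro i h
    by_cases hi : i.val < 4
    · exact hO.1 i (by rw [← cremonaOctad_of_lt O hi, h])
    · exact hcne (not_lt.mp hi) 0 (by rw [h]; rfl)
  refine ⟨h0, fun i j c h => ?_, fun u hu => ⟨fun hq => ?_, ?_⟩⟩
  · have hc : c ≠ 0 := by rintro rfl; exact h0 i (by rw [h, zero_smul])
    by_cases hi : i.val < 4 <;> by_cases hj : j.val < 4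
    · rw [cremonaOctad_of_lt O hi, cremonaOctad_of_lt O hj] at h
      exact hO.2.1 i j c h
    · obtain ⟨k, hk⟩ := hz hi
      rw [h] at hk
      exact absurd hk (mul_ne_zero hc (hcne (not_lt.mp hj) k))
    · obtain ⟨k, hk⟩ := hz hj
      exact absurd (by rw [h]; simp [hk]) (hcne (not_lt.mp hi) k)
    · rw [cremonaOctad_of_le O (not_lt.mp hi), cremonaOctad_of_le O (not_lt.mp hj)] at h
      refine hO.2.1 i j c⁻¹ ?_
      ext k
      have := congrArg (·⁻¹) (congrFun h k)
      simpa [mul_comm] using this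
  · by_cases hu0 : ∃ k, u k = 0
    · obtain ⟨k, hk⟩ := hu0
      obtain ⟨j, c, h⟩ := hO.exists_smul_single hG hD hbase hq hk
      exact ⟨firstFour j, c, by rw [cremonaOctad_of_lt O j.isLt, hbase, h]⟩
    · push Not at hu0
      have hinv : ∀ j, u⁻¹ j ≠ 0 := fun j => inv_ne_zero (hu0 j)
      have huinv : u⁻¹ ≠ 0 := fun h => hinv 0 (by rw [h]; rfl)
      obtain ⟨i, c, h⟩ := (hO.2.2 u⁻¹ huinv).mp fun t => by
        have h1 := bifidMatrix_inv_inv (hsym t) (hd t) hinv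
        rw [inv_inv, hq t] at h1
        exact (mul_eq_zero.mp h1.symm).resolve_left (inv_ne_zero (by simp [hu0]))
      have hi : ¬ i.val < 4 := by
        intro hi
        obtain ⟨k, hk⟩ := hz hi
        rw [cremonaOctad_of_lt O hi] at hk
        exact hinv k (by rw [h]; simp [hk])
      refine ⟨i, c⁻¹, ?_⟩
      rw [cremonaOctad_of_le O (not_lt.mp hi), ← inv_inv u, h]
      ext j
      simp [mul_comm]
  · rintro ⟨i, c, rfl⟩ t
    rw [Matrix.mulVec_smul, dotProduct_smul, smul_dotProduct]
    by_cases hi : i.val < 4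
    · obtain ⟨k, rfl⟩ := exists_firstFour_eq hi
      rw [cremonaOctad_of_lt O hi, hbase]
      have : bifidMatrix (G t) k k = 0 := by fin_cases k <;> rfl
      simp [this]
    · rw [cremonaOctad_of_le O (not_lt.mp hi),
        bifidMatrix_inv_inv (hsym t) (hd t) (hne (not_lt.mp hi))]
      have : O i ⬝ᵥ (G t).mulVec (O i) = 0 := congrFun (hO.polarVec_self i) t
      simp [this]

theorem isSmoothForm_det_bifidMatrix (hG : ∀ t, (G t).IsSymm)
    (hD : IsSmoothForm (linearMatrix G).det) (hd : ∀ t k, G t k k = 0) :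
    IsSmoothForm (linearMatrix fun t => bifidMatrix (G t)).det := by
  have hs (i j) : linearMatrix G i j = linearMatrix G j i := by
    simp only [linearMatrix, Matrix.of_apply]
    exact congrArg linearForm (funext fun t => (hG t).apply j i)
  rw [linearMatrix_bifidMatrix, det_bifidMatrix hs]
  · exact hD
  · intro i
    simp only [linearMatrix, Matrix.of_apply, hd]
    exact linearForm_zero

end Cremona

/-! ### Planes and proportional forms in three-space. -/

section ThreeSpace

variable {F : Type*} [Field F]

theorem det_eq_zero_of_orthogonal {a b c n : Fin 3 → F} (hn : n ≠ 0) (ha : a ⬝ᵥ n = 0)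
    (hb : b ⬝ᵥ n = 0) (hc : c ⬝ᵥ n = 0) : (Matrix.of ![a, b, c]).det = 0 := by
  refine Matrix.exists_mulVec_eq_zero_iff.mp ⟨n, hn, ?_⟩
  ext i
  fin_cases i <;> simpa [Matrix.mulVec]

theorem dotProduct_crossProduct_eq_det (a b c : Fin 3 → F) :
    a ⬝ᵥ crossProduct b c = (Matrix.of ![a, b, c]).det := by
  simp [Matrix.det_fin_three, cross_apply, dotProduct, Fin.sum_univ_three]
  ring

/-- If two independent vectors `c`, `c'` lie in the plane spanned by `x`, `y` and in the plane
spanned by `x'`, `y'`, then these planes are equal. -/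
theorem det_eq_zero_of_planes {c c' x y x' y' : Fin 3 → F} (hc : LinearIndependent F ![c, c'])
    (hxy : LinearIndependent F ![x, y]) (hxy' : LinearIndependent F ![x', y'])
    (h1 : (Matrix.of ![c, x, y]).det = 0) (h2 : (Matrix.of ![c', x, y]).det = 0)
    (h1' : (Matrix.of ![c, x', y']).det = 0) (h2' : (Matrix.of ![c', x', y']).det = 0) :
    (Matrix.of ![c, x, y']).det = 0 := by
  have hn := crossProduct_ne_zero_iff_linearIndependent.mpr hc
  have key {x y : Fin 3 → F} (hxy : LinearIndependent F ![x, y])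
      (h1 : (Matrix.of ![c, x, y]).det = 0) (h2 : (Matrix.of ![c', x, y]).det = 0) :
      x ⬝ᵥ crossProduct c c' = 0 ∧ y ⬝ᵥ crossProduct c c' = 0 := by
    have hm := crossProduct_ne_zero_iff_linearIndependent.mpr hxy
    rw [← dotProduct_crossProduct_eq_det] at h1 h2
    rw [dotProduct_crossProduct_eq_det, dotProduct_crossProduct_eq_det]
    exact ⟨det_eq_zero_of_orthogonal hm (dot_self_cross _ _) h1 h2,
      det_eq_zero_of_orthogonal hm (dot_cross_self _ _) h1 h2⟩
  exact det_eq_zero_of_orthogonal hn (dot_self_cross _ _) (key hxy h1 h2).1 (key hxy' h1' h2').2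

theorem exists_smul_of_ker_le {β δ : Fin 3 → F} (hβ : β ≠ 0)
    (h : ∀ p, β ⬝ᵥ p = 0 → δ ⬝ᵥ p = 0) : ∃ c : F, δ = c • β := by
  obtain ⟨t, ht⟩ := Function.ne_iff.mp hβ
  refine ⟨δ t / β t, ?_⟩
  ext s
  -- The test vector β_t e_s - β_s e_t is orthogonal to β and isolates the ratio of the coordinates
  -- s and t.
  have := h (β t • Pi.single s 1 - β s • Pi.single t 1) (by
    simp only [dotProduct_sub, dotProduct_smul, dotProduct_single_one, smul_eq_mul]; ring)
  simp only [dotProduct_sub, dotProduct_smul, dotProduct_single_one, smul_eq_mul] at this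
  have ht' : β t ≠ 0 := ht
  simp only [Pi.smul_apply, smul_eq_mul]
  field_simp
  linear_combination this

end ThreeSpace

/-! ### Quadrics through a twisted cubic. -/

section TwistedCubic

variable {F : Type*} [Field F]

/-- The three differences `v₀ a₀ - v_j a_j`. -/
def residualVec (a v : Fin 4 → F) : Fin 3 → F :=
  ![v 0 * a 0 - v 1 * a 1, v 0 * a 0 - v 2 * a 2, v 0 * a 0 - v 3 * a 3]

/-- The coordinates of the quadric `N` through the twisted cubic `(1 / (s a_j + t b_j))_j` with
respect to the minors of the matrix with rows `residualVec a`, `residualVec b`. -/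
def cubicCoeff (a b : Fin 4 → F) (N : Matrix (Fin 4) (Fin 4) F) : Fin 3 → F :=
  ![N 2 3 / (a 2 * b 3 - a 3 * b 2), -(N 1 3 / (a 1 * b 3 - a 3 * b 1)),
    N 1 2 / (a 1 * b 2 - a 2 * b 1)]

theorem cubicCoeff_add (a b : Fin 4 → F) (N N' : Matrix (Fin 4) (Fin 4) F) :
    cubicCoeff a b (N + N') = cubicCoeff a b N + cubicCoeff a b N' := by
  ext i; fin_cases i <;> simp [cubicCoeff] <;> ring

theorem cubicCoeff_smul (a b : Fin 4 → F) (r : F) (N : Matrix (Fin 4) (Fin 4) F) :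
    cubicCoeff a b (r • N) = r • cubicCoeff a b N := by
  ext i; fin_cases i <;> simp [cubicCoeff] <;> ring

/-- A quadric through the coordinate points whose Cremona transform contains the line through `a`
and `b` is a combination of the minors that cut out the twisted cubic. -/
theorem dotProduct_mulVec_eq_det {N : Matrix (Fin 4) (Fin 4) F} (hN : ∀ i j, N i j = N j i)
    (hd : ∀ i, N i i = 0) {a b : Fin 4 → F}
    (hab : ∀ i j, i ≠ j → a i * b j - a j * b i ≠ 0) [NeZero (2 : F)]
    (haa : a ⬝ᵥ (bifidMatrix N).mulVec a = 0) (hbb : b ⬝ᵥ (bifidMatrix N).mulVec b = 0)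
    (h : a ⬝ᵥ (bifidMatrix N).mulVec b = 0) (u v : Fin 4 → F) :
    u ⬝ᵥ N.mulVec v = (Matrix.of ![cubicCoeff a b N, residualVec a u, residualVec b v]).det +
      (Matrix.of ![cubicCoeff a b N, residualVec a v, residualVec b u]).det := by
  rw [dotProduct_bifidMatrix_mulVec] at haa hbb h
  have h12 := hab 1 2 (by decide)
  have h13 := hab 1 3 (by decide)
  have h23 := hab 2 3 (by decide)
  -- Half of the transformed quadric at the point x a - y b of the line.
  have key (x y : F) : N 0 1 * ((a 2 * x - b 2 * y) * (a 3 * x - b 3 * y)) +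
      N 0 2 * ((a 1 * x - b 1 * y) * (a 3 * x - b 3 * y)) +
      N 0 3 * ((a 1 * x - b 1 * y) * (a 2 * x - b 2 * y)) +
      N 1 2 * ((a 0 * x - b 0 * y) * (a 3 * x - b 3 * y)) +
      N 1 3 * ((a 0 * x - b 0 * y) * (a 2 * x - b 2 * y)) +
      N 2 3 * ((a 0 * x - b 0 * y) * (a 1 * x - b 1 * y)) = 0 := by
    refine mul_left_cancel₀ (two_ne_zero (α := F)) ?_
    linear_combination x ^ 2 * haa - 2 * x * y * h + y ^ 2 * hbb
  have e4 : N 1 2 = (a 1 * b 2 - a 2 * b 1) * (N 1 2 / (a 1 * b 2 - a 2 * b 1)) :=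
    (mul_div_cancel₀ _ h12).symm
  have e5 : N 1 3 = (a 1 * b 3 - a 3 * b 1) * (N 1 3 / (a 1 * b 3 - a 3 * b 1)) :=
    (mul_div_cancel₀ _ h13).symm
  have e6 : N 2 3 = (a 2 * b 3 - a 3 * b 2) * (N 2 3 / (a 2 * b 3 - a 3 * b 2)) :=
    (mul_div_cancel₀ _ h23).symm
  -- At the point where the line meets the plane of vanishing coordinate 1, only three terms of
  -- `key` survive, which determines N₀₁; `e2` and `e3` use coordinates 2 and 3.
  have e1 : N 0 1 = (a 0 * b 1 - a 1 * b 0) *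
      (N 1 2 / (a 1 * b 2 - a 2 * b 1) + N 1 3 / (a 1 * b 3 - a 3 * b 1)) := by
    refine mul_left_cancel₀ (mul_ne_zero h12 h13) ?_
    linear_combination key (b 1) (a 1) +
      (a 0 * b 1 - a 1 * b 0) * (a 1 * b 3 - a 3 * b 1) * e4 +
      (a 0 * b 1 - a 1 * b 0) * (a 1 * b 2 - a 2 * b 1) * e5
  have e2 : N 0 2 = (a 0 * b 2 - a 2 * b 0) *
      (N 2 3 / (a 2 * b 3 - a 3 * b 2) - N 1 2 / (a 1 * b 2 - a 2 * b 1)) := by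
    refine mul_left_cancel₀ (mul_ne_zero h12 h23) ?_
    linear_combination -key (b 2) (a 2) -
      (a 0 * b 2 - a 2 * b 0) * (a 2 * b 3 - a 3 * b 2) * e4 +
      (a 0 * b 2 - a 2 * b 0) * (a 1 * b 2 - a 2 * b 1) * e6
  have e3 : N 0 3 = -((a 0 * b 3 - a 3 * b 0) *
      (N 2 3 / (a 2 * b 3 - a 3 * b 2) + N 1 3 / (a 1 * b 3 - a 3 * b 1))) := by
    refine mul_left_cancel₀ (mul_ne_zero h13 h23) ?_
    linear_combination key (b 3) (a 3) -
      (a 0 * b 3 - a 3 * b 0) * (a 2 * b 3 - a 3 * b 2) * e5 -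
      (a 0 * b 3 - a 3 * b 0) * (a 1 * b 3 - a 3 * b 1) * e6
  rw [dotProduct_mulVec_of_diag hN hd]
  simp only [Matrix.det_fin_three, cubicCoeff, residualVec, Matrix.of_apply, Matrix.cons_val]
  linear_combination (u 0 * v 1 + u 1 * v 0) * e1 + (u 0 * v 2 + u 2 * v 0) * e2 +
    (u 0 * v 3 + u 3 * v 0) * e3 + (u 1 * v 2 + u 2 * v 1) * e4 + (u 1 * v 3 + u 3 * v 1) * e5 +
    (u 2 * v 3 + u 3 * v 2) * e6

/-- A point with nonzero coordinates off the twisted cubic. -/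
theorem linearIndependent_residualVec {a b w : Fin 4 → F} (hw : ∀ j, w j ≠ 0)
    (hli : LinearIndependent F ![a, b, w⁻¹]) :
    LinearIndependent F ![residualVec a w, residualVec b w] := by
  rw [LinearIndependent.pair_iff]
  intro s t hst
  have h0 := congrFun hst 0
  have h1 := congrFun hst 1
  have h2 := congrFun hst 2
  simp only [residualVec, Pi.add_apply, Pi.smul_apply, smul_eq_mul, Pi.zero_apply,
    Matrix.cons_val] at h0 h1 h2
  -- A dependency makes w_j (s a_j + t b_j) independent of j, which puts w⁻¹ on the line through a
  -- and b.
  have key (j : Fin 4) : w j * (s * a j + t * b j) = w 0 * (s * a 0 + t * b 0) := by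
    obtain rfl | rfl | rfl | rfl : j = 0 ∨ j = 1 ∨ j = 2 ∨ j = 3 := by omega
    · rfl
    · linear_combination -h0
    · linear_combination -h1
    · linear_combination -h2
  have h3 := Fintype.linearIndependent_iff.mp hli ![s, t, -(w 0 * (s * a 0 + t * b 0))] (by
    ext j
    simp only [Fin.sum_univ_three, Matrix.cons_val, Pi.add_apply, Pi.smul_apply, smul_eq_mul,
      Pi.inv_apply, Pi.zero_apply]
    rw [← key j]
    have := hw j
    field_simp
    ring)
  exact ⟨by simpa using h3 0, by simpa using h3 1⟩

end TwistedCubic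

/-! ### Bitangents between the last four points. -/

section Complementary

variable {G : Fin 3 → Matrix (Fin 4) (Fin 4) ℂ} {O : Matrix (Fin 8) (Fin 4) ℂ}

/-- The quadric of the net with parameter `p`. -/
def netMember {F : Type*} [Field F] (G : Fin 3 → Matrix (Fin 4) (Fin 4) F) (p : Fin 3 → F) :
    Matrix (Fin 4) (Fin 4) F :=
  p 0 • G 0 + p 1 • G 1 + p 2 • G 2

theorem dotProduct_netMember {F : Type*} [Field F] (G : Fin 3 → Matrix (Fin 4) (Fin 4) F)
    (p : Fin 3 → F) (u v : Fin 4 → F) :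
    u ⬝ᵥ (netMember G p).mulVec v = polarVec G u v ⬝ᵥ p := by
  simp only [netMember, Matrix.add_mulVec, Matrix.smul_mulVec, dotProduct_add, dotProduct_smul,
    smul_eq_mul]
  rw [dotProduct_comm _ p, show p ⬝ᵥ polarVec G u v = ∑ t, p t * polarVec G u v t from rfl,
    Fin.sum_univ_three]
  rfl

theorem bifidMatrix_netMember {F : Type*} [Field F] (G : Fin 3 → Matrix (Fin 4) (Fin 4) F)
    (p : Fin 3 → F) : bifidMatrix (netMember G p) = netMember (fun t => bifidMatrix (G t)) p := by
  ext i j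
  fin_cases i <;> fin_cases j <;> simp [bifidMatrix, netMember]

/-- It suffices that every parameter p killed by b'_ij is killed by b_kl. Such p form a pencil, and
`cubicCoeff` maps it injectively onto a plane in three-space. Vanishing at O k and at O l identifies
this plane with the span of the two residual vectors at each point, so the polarized determinants
vanish at the pair as well. -/
theorem IsCayleyOctad.polarVec_complementary (hG : ∀ t, (G t).IsSymm)
    (hD : IsSmoothForm (linearMatrix G).det) (hO : IsCayleyOctad G O)
    (hbase : ∀ k, O (firstFour k) = Pi.single k 1) {i j k l : Fin 8} (hi : 4 ≤ i.val)
    (hj : 4 ≤ j.val) (hk : 4 ≤ k.val) (hl : 4 ≤ l.val) (hinj : Function.Injective ![i, j, k, l]) :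
    ∃ c : ℂ, c ≠ 0 ∧ polarVec (fun t => bifidMatrix (G t)) (_root_.cremonaOctad O i)
      (_root_.cremonaOctad O j) = c • polarVec G (O k) (O l) := by
  have hij : i ≠ j := hinj.ne (by decide : (0 : Fin 4) ≠ 1)
  have hik : i ≠ k := hinj.ne (by decide : (0 : Fin 4) ≠ 2)
  have hil : i ≠ l := hinj.ne (by decide : (0 : Fin 4) ≠ 3)
  have hjk : j ≠ k := hinj.ne (by decide : (1 : Fin 4) ≠ 2)
  have hjl : j ≠ l := hinj.ne (by decide : (1 : Fin 4) ≠ 3)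
  have hkl : k ≠ l := hinj.ne (by decide : (2 : Fin 4) ≠ 3)
  have hd := hO.diag_eq_zero hbase
  have hB : ∀ t, (bifidMatrix (G t)).IsSymm := fun t => bifidMatrix_isSymm _
  have hBD := isSmoothForm_det_bifidMatrix hG hD hd
  have hC := hO.cremonaOctad hG hD hbase
  have hne := fun {m} hm j => hO.entry_ne_zero hG hD hbase (i := m) hm j
  set a := _root_.cremonaOctad O i with ha
  set b := _root_.cremonaOctad O j with hb
  have hab (x y : Fin 4) (hxy : x ≠ y) : a x * b y - a y * b x ≠ 0 := by
    rw [ha, hb, cremonaOctad_of_le O hi, cremonaOctad_of_le O hj]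
    have h1 := hO.minor_ne_zero hG hD hbase hi hj hij hxy
    have := hne hi x
    have := hne hi y
    have := hne hj x
    have := hne hj y
    intro h
    apply h1
    simp only [Pi.inv_apply] at h
    field_simp at h
    linear_combination -h
  have hres {m : Fin 8} (hm : 4 ≤ m.val) (him : i ≠ m) (hjm : j ≠ m) :
      LinearIndependent ℂ ![residualVec a (O m), residualVec b (O m)] := by
    refine linearIndependent_residualVec (hne hm) ?_
    rw [← cremonaOctad_of_le O hm]
    exact hC.linearIndependent_three hB hBD hij him hjm
  let N := netMember G
  have hNs (p) (x y) : N p x y = N p y x := by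
    simp [N, netMember, (hG _).apply x y]
  have hNd (p) (x) : N p x x = 0 := by simp [N, netMember, hd]
  -- The condition on p says that the transformed quadric contains the whole line through a and b.
  have hmain : ∀ p, polarVec (fun t => bifidMatrix (G t)) a b ⬝ᵥ p = 0 → ∀ u v,
      polarVec G u v ⬝ᵥ p =
        (Matrix.of ![cubicCoeff a b (N p), residualVec a u, residualVec b v]).det +
        (Matrix.of ![cubicCoeff a b (N p), residualVec a v, residualVec b u]).det := by
    intro p hp u v
    rw [← dotProduct_netMember]
    refine dotProduct_mulVec_eq_det (hNs p) (hNd p) hab ?_ ?_ ?_ u v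
    · rw [bifidMatrix_netMember, dotProduct_netMember, ha, hC.polarVec_self, zero_dotProduct]
    · rw [bifidMatrix_netMember, dotProduct_netMember, hb, hC.polarVec_self, zero_dotProduct]
    · rw [bifidMatrix_netMember, dotProduct_netMember, hp]
  -- Zero cubic coefficients make the quadric itself zero, which transversality at O i excludes
  -- unless p = 0.
  have hzero : ∀ p, polarVec (fun t => bifidMatrix (G t)) a b ⬝ᵥ p = 0 →
      cubicCoeff a b (N p) = 0 → p = 0 := by
    intro p hp hcp
    refine eq_zero_of_polarVec_dotProduct hG hD (hO.1 i) (hO.polarVec_self i) fun v => ?_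
    rw [hmain p hp, hcp, Matrix.det_eq_zero_of_row_eq_zero 0 (by simp),
      Matrix.det_eq_zero_of_row_eq_zero 0 (by simp), add_zero]
  have hself : ∀ p, polarVec (fun t => bifidMatrix (G t)) a b ⬝ᵥ p = 0 → ∀ m,
      (Matrix.of ![cubicCoeff a b (N p), residualVec a (O m), residualVec b (O m)]).det = 0 := by
    intro p hp m
    have h := hmain p hp (O m) (O m)
    rw [hO.polarVec_self, zero_dotProduct, ← two_mul] at h
    exact (mul_eq_zero.mp h.symm).resolve_left two_ne_zero
  have hker : ∀ p, polarVec (fun t => bifidMatrix (G t)) a b ⬝ᵥ p = 0 →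
      polarVec G (O k) (O l) ⬝ᵥ p = 0 := by
    intro p hp
    by_cases hp0 : p = 0
    · rw [hp0, dotProduct_zero]
    obtain ⟨t, ht⟩ := Function.ne_iff.mp hp0
    obtain ⟨q, hq0, hq, hqt⟩ := exists_common_zero_of_two_forms
      (polarVec (fun t => bifidMatrix (G t)) a b) (Pi.single t 1)
    have hqt : q t = 0 := by simpa using hqt
    have hli : LinearIndependent ℂ ![cubicCoeff a b (N p), cubicCoeff a b (N q)] := by
      rw [LinearIndependent.pair_iff]
      intro x y hxy
      have h1 : N (x • p + y • q) = x • N p + y • N q := by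
        simp only [N, netMember, Pi.add_apply, Pi.smul_apply, smul_eq_mul]
        module
      have h2 := hzero (x • p + y • q) (by simp [dotProduct_add, hp, hq])
        (by rw [h1, cubicCoeff_add, cubicCoeff_smul, cubicCoeff_smul, hxy])
      have hx : x = 0 := by
        have := congrFun h2 t
        simpa [hqt, show p t ≠ 0 from ht] using this
      refine ⟨hx, ?_⟩
      rw [hx, zero_smul, zero_add] at h2
      exact (smul_eq_zero.mp h2).resolve_right hq0
    rw [hmain p hp,
      det_eq_zero_of_planes hli (hres hk hik hjk) (hres hl hil hjl) (hself p hp k) (hself q hq k)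
        (hself p hp l) (hself q hq l),
      det_eq_zero_of_planes hli (hres hl hil hjl) (hres hk hik hjk) (hself p hp l) (hself q hq l)
        (hself p hp k) (hself q hq k), add_zero]
  obtain ⟨c, hc⟩ := exists_smul_of_ker_le (hC.polarVec_ne_zero hB hBD hij) hker
  have hc0 : c ≠ 0 := by
    rintro rfl
    exact hO.polarVec_ne_zero hG hD hkl (by rw [hc, zero_smul])
  exact ⟨c⁻¹, inv_ne_zero hc0, by rw [hc, inv_smul_smul₀ hc0]⟩

end Complementary

/-! ### From ℂ back to K. -/

section Descent

variable {K : IntermediateField ℚ ℂ}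

theorem polarVec_toComplex (A : Fin 3 → Matrix (Fin 4) (Fin 4) K) (O : Matrix (Fin 8) (Fin 4) K)
    (i j : Fin 8) : polarVec (fun t => toComplex (A t)) (toComplex O i) (toComplex O j) =
      algebraMap K ℂ ∘ polarVec A (O i) (O j) :=
  polarVec_map (algebraMap K ℂ) A (O i) (O j)

/-- Vectors over `K` that are proportional over `ℂ` are proportional over `K`. -/
theorem exists_smul_of_algebraMap {v w : Fin 3 → K} {c : ℂ} (hc : c ≠ 0) (hw : w ≠ 0)
    (h : algebraMap K ℂ ∘ v = c • (algebraMap K ℂ ∘ w)) : ∃ d : K, d ≠ 0 ∧ v = d • w := by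
  obtain ⟨t, ht⟩ := Function.ne_iff.mp hw
  have ht : w t ≠ 0 := ht
  have hcd : c = algebraMap K ℂ (v t / w t) := by
    have := congrFun h t
    simp only [Function.comp_apply, Pi.smul_apply, smul_eq_mul] at this
    rw [map_div₀, this, mul_div_cancel_right₀ _ (by simpa using ht)]
  refine ⟨v t / w t, fun h0 => hc (by rw [hcd, h0, map_zero]), ?_⟩
  ext1 s
  have := congrFun h s
  rw [hcd] at this
  simp only [Function.comp_apply, Pi.smul_apply, smul_eq_mul, ← map_mul] at this
  exact (algebraMap K ℂ).injective this

theorem toComplex_cremonaOctad (O : Matrix (Fin 8) (Fin 4) K) :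
    toComplex (cremonaOctad O) = cremonaOctad (toComplex O) := by
  ext i j
  simp only [toComplex, cremonaOctad, Matrix.map_apply, Matrix.of_apply]
  split_ifs <;> simp

theorem toComplex_bifidMatrix (N : Matrix (Fin 4) (Fin 4) K) :
    toComplex (bifidMatrix N) = bifidMatrix (toComplex N) := by
  ext i j
  fin_cases i <;> fin_cases j <;> simp [toComplex, bifidMatrix]

theorem toComplex_mul {m n o : Type*} [Fintype n] (M : Matrix m n K) (N : Matrix n o K) :
    toComplex (M * N) = toComplex M * toComplex N :=
  Matrix.map_mul

theorem toComplex_principalBlock (A : Fin 3 → Matrix (Fin 4) (Fin 4) K)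
    (Q : Matrix (Fin 8) (Fin 4) K) (t : Fin 3) :
    toComplex (principalBlock A Q t) =
      principalBlock (fun t => toComplex (A t)) (toComplex Q) t := by
  have h : toComplex Q.transpose = (toComplex Q).transpose := rfl
  have h2 : toComplex (principalBlock A Q t) =
      (toComplex (Q * A t * Q.transpose)).submatrix firstFour firstFour := rfl
  rw [h2, toComplex_mul, toComplex_mul, h]
  rfl

theorem toComplex_normalizedOctad {Q : Matrix (Fin 8) (Fin 4) K}
    (hQ : IsUnit (Q.submatrix firstFour id).det) :
    toComplex (normalizedOctad Q) = normalizedOctad (toComplex Q) := by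
  have h1 : toComplex (Q.submatrix firstFour id) * toComplex (Q.submatrix firstFour id)⁻¹ = 1 := by
    rw [← toComplex_mul, Matrix.mul_nonsing_inv _ hQ, toComplex,
      Matrix.map_one _ (map_zero _) (map_one _)]
  rw [normalizedOctad, toComplex_mul, normalizedOctad, ← Matrix.inv_eq_right_inv h1]
  rfl

theorem toComplex_linearMatrix_det (A : Fin 3 → Matrix (Fin 4) (Fin 4) K) :
    MvPolynomial.map (algebraMap K ℂ) (linearMatrix A).det =
      (linearMatrix fun t => toComplex (A t)).det := by
  rw [RingHom.map_det]
  congr 1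
  ext1 i j
  simp [linearMatrix, linearForm, toComplex]

theorem SamePoints.toComplex {O O' : Matrix (Fin 8) (Fin 4) K} (h : SamePoints O O') :
    SamePoints (_root_.toComplex O) (_root_.toComplex O') := by
  intro i
  obtain ⟨c, hc, hi⟩ := h i
  refine ⟨algebraMap K ℂ c, by simpa using hc, ?_⟩
  ext j
  have := congrArg (algebraMap K ℂ) (congrFun hi j)
  simpa [_root_.toComplex] using this

end Descent

/-! ### The coordinate and mixed bitangents of the transformed net. -/

section Transformed

variable {G : Fin 3 → Matrix (Fin 4) (Fin 4) ℂ} {O : Matrix (Fin 8) (Fin 4) ℂ}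

theorem polarVec_bifid_coordinate (hG : ∀ t, (G t).IsSymm)
    (hbase : ∀ k, O (firstFour k) = Pi.single k 1) {i j k l : Fin 8}
    (h : ({i, j, k, l} : Finset (Fin 8)) = {0, 1, 2, 3}) :
    polarVec (fun t => bifidMatrix (G t)) (cremonaOctad O i) (cremonaOctad O j) =
      polarVec G (O k) (O l) := by
  have h4 : ∃ i' j' k' l' : Fin 4, firstFour i' = i ∧ firstFour j' = j ∧ firstFour k' = k ∧
      firstFour l' = l ∧ i' ≠ j' ∧ i' ≠ k' ∧ i' ≠ l' ∧ j' ≠ k' ∧ j' ≠ l' ∧ k' ≠ l' := by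
    have hmem (m : Fin 8) (hm : m ∈ ({i, j, k, l} : Finset (Fin 8))) : m.val < 4 := by
      rw [h] at hm
      revert m; decide
    have hcard : ({i, j, k, l} : Finset (Fin 8)).card = 4 := by rw [h]; rfl
    obtain ⟨i', rfl⟩ := exists_firstFour_eq (hmem i (by simp))
    obtain ⟨j', rfl⟩ := exists_firstFour_eq (hmem j (by simp))
    obtain ⟨k', rfl⟩ := exists_firstFour_eq (hmem k (by simp))
    obtain ⟨l', rfl⟩ := exists_firstFour_eq (hmem l (by simp))
    refine ⟨i', j', k', l', rfl, rfl, rfl, rfl, ?_⟩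
    clear hmem h
    revert i' j' k' l'
    decide
  obtain ⟨i', j', k', l', rfl, rfl, rfl, rfl, hij, hik, hil, hjk, hjl, hkl⟩ := h4
  ext t
  rw [cremonaOctad_of_lt O i'.isLt, cremonaOctad_of_lt O j'.isLt]
  simp [polarVec, hbase, bifidMatrix_apply_of_ne (fun x y => (hG t).apply y x) hij hik hil hjk hjl
    hkl]

theorem IsCayleyOctad.polarVec_bifid_mixed (hG : ∀ t, (G t).IsSymm)
    (hD : IsSmoothForm (linearMatrix G).det) (hO : IsCayleyOctad G O)
    (hbase : ∀ k, O (firstFour k) = Pi.single k 1) {i j : Fin 8} (hi : i.val < 4)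
    (hj : 4 ≤ j.val) : ∃ c : ℂ, c ≠ 0 ∧ polarVec (fun t => bifidMatrix (G t))
      (_root_.cremonaOctad O i) (_root_.cremonaOctad O j) = c • polarVec G (O i) (O j) := by
  obtain ⟨k, rfl⟩ := exists_firstFour_eq hi
  have hne := hO.entry_ne_zero hG hD hbase hj
  refine ⟨-(O j k ^ 2 * (O j 0 * O j 1 * O j 2 * O j 3)⁻¹), by simp [hne], ?_⟩
  ext t
  rw [cremonaOctad_of_lt O hi, cremonaOctad_of_le O hj, hbase]
  exact bifidMatrix_single_inv (fun x y => (hG t).apply y x) (hO.diag_eq_zero hbase t) hne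
    (congrFun (hO.polarVec_self j) t) k

end Transformed

/-! ### Bitangent matrices over K and the main theorem. -/

section BitangentMatrices

variable {F : Type*} [Field F]

/-- Rescaling the octad rows multiplies an entry by scalars of K, and proportionality over ℂ
descends to K because the right-hand form is nonzero. -/
theorem exists_smul_bitangentMatrix {K : IntermediateField ℚ ℂ}
    {A B : Fin 3 → Matrix (Fin 4) (Fin 4) K} {O O' O'' : Matrix (Fin 8) (Fin 4) K}
    (hO : SamePoints O' O'') {i j k l : Fin 8} (hne : polarVec A (O k) (O l) ≠ 0)
    (h : ∃ c : ℂ, c ≠ 0 ∧ polarVec (fun t => toComplex (B t)) (toComplex O'' i) (toComplex O'' j) =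
      c • polarVec (fun t => toComplex (A t)) (toComplex O k) (toComplex O l)) :
    ∃ c : K, c ≠ 0 ∧ bitangentMatrix B O' i j = c • bitangentMatrix A O k l := by
  obtain ⟨c, hc, h⟩ := h
  rw [polarVec_toComplex, polarVec_toComplex] at h
  obtain ⟨d, hd, h⟩ := exists_smul_of_algebraMap hc hne h
  obtain ⟨x, hx, hi⟩ := hO i
  obtain ⟨y, hy, hj⟩ := hO j
  refine ⟨x * y * d, mul_ne_zero (mul_ne_zero hx hy) hd, ?_⟩
  rw [bitangentMatrix_apply, bitangentMatrix_apply, ← linearForm_smul, hi, hj,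
    polarVec_smul_left, polarVec_smul_right, h, smul_smul, smul_smul]

end BitangentMatrices

theorem mainTheorem6
    (f : MvPolynomial (Fin 3) ℂ) (hf : f.IsHomogeneous 4) (hsmooth : IsSmoothForm f)
    (K : IntermediateField ℚ ℂ) (hK : bitangentField f ≤ K)
    (A : Fin 3 → Matrix (Fin 4) (Fin 4) K) (hA : ∀ t, (A t).IsSymm)
    (γ : ℂ) (hγ : γ ≠ 0)
    (hdet : MvPolynomial.map (algebraMap K ℂ) (linearMatrix A).det = MvPolynomial.C γ * f)
    (P : Matrix (Fin 8) (Fin 4) ℂ) (hP : IsCayleyOctad (fun t => toComplex (A t)) P) :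
    -- the points of the octad are `K`-rational
    (∃ Q : Matrix (Fin 8) (Fin 4) K, SamePoints (toComplex Q) P) ∧
    -- for all coordinate vectors over `K` of the points of the octad
    ∀ Q : Matrix (Fin 8) (Fin 4) K, SamePoints (toComplex Q) P →
      -- the octad `O` of `M₁₂₃₄` and its Cremona transform are well defined
      IsUnit (Q.submatrix firstFour id).det ∧
      IsCayleyOctad (fun t => toComplex (principalBlock A Q t)) (toComplex (normalizedOctad Q)) ∧
      bitangentMatrix (principalBlock A Q) (normalizedOctad Q) = bitangentMatrix A Q ∧
      (∀ i : Fin 8, 4 ≤ i.val → ∀ j, normalizedOctad Q i j ≠ 0) ∧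
      -- for all coordinate vectors over `K` of the points of the Cremona transform
      ∀ O' : Matrix (Fin 8) (Fin 4) K, SamePoints O' (cremonaOctad (normalizedOctad Q)) →
        IsCayleyOctad (fun t => toComplex (bifidBlock A Q t)) (toComplex O') ∧
        (∀ i j k l : Fin 8,
          (({i, j, k, l} : Finset (Fin 8)) = {0, 1, 2, 3} ∨
            ({i, j, k, l} : Finset (Fin 8)) = {4, 5, 6, 7}) →
          ∃ c : K, c ≠ 0 ∧ bitangentMatrix (bifidBlock A Q) O' i j =
            c • bitangentMatrix (principalBlock A Q) (normalizedOctad Q) k l) ∧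
        (∀ i j : Fin 8, i ≠ j → (({i, j} : Finset (Fin 8)) ∩ {0, 1, 2, 3}).card = 1 →
          ∃ c : K, c ≠ 0 ∧ bitangentMatrix (bifidBlock A Q) O' i j =
            c • bitangentMatrix (principalBlock A Q) (normalizedOctad Q) i j) := by
  have hAc (t) : (toComplex (A t)).IsSymm := (hA t).map _
  rw [toComplex_linearMatrix_det] at hdet
  have hD : IsSmoothForm (linearMatrix fun t => toComplex (A t)).det := by
    rw [hdet]; exact hsmooth.C_mul hγ
  refine ⟨exists_rational_octad hK hA hγ hD hdet hP, fun Q hQP => ?_⟩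
  have hQ := hP.of_samePoints hQP
  have hdetC := hQ.det_submatrix_ne_zero hAc hD firstFour_injective
  have hunit : IsUnit (Q.submatrix firstFour id).det := by
    refine isUnit_iff_ne_zero.mpr fun h => hdetC ?_
    have h1 : (toComplex Q).submatrix firstFour id =
        (algebraMap K ℂ).mapMatrix (Q.submatrix firstFour id) := rfl
    rw [h1, ← RingHom.map_det, h, map_zero]
  set G := principalBlock A Q with hGdef
  set O := normalizedOctad Q with hOdef
  set Gc : Fin 3 → Matrix (Fin 4) (Fin 4) ℂ := fun t => toComplex (G t) with hGc
  have hGc' : Gc = baseChange (fun t => toComplex (A t)) ((toComplex Q).submatrix firstFour id) := by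
    rw [← principalBlock_eq_baseChange]
    exact funext fun t => toComplex_principalBlock A Q t
  have hOc : toComplex O = normalizedOctad (toComplex Q) := toComplex_normalizedOctad hunit
  have hO : IsCayleyOctad Gc (toComplex O) := by
    rw [hGc', hOc]
    exact hQ.baseChange (isUnit_iff_ne_zero.mpr hdetC)
  have hGs (t) : (Gc t).IsSymm := by
    rw [hGc']; exact baseChange_isSymm hAc _ t
  have hGD : IsSmoothForm (linearMatrix Gc).det := by
    rw [hGc']; exact isSmoothForm_det_baseChange hD hdetC
  have hbase (k) : toComplex O (firstFour k) = Pi.single k 1 := by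
    rw [hOc]; exact normalizedOctad_firstFour (isUnit_iff_ne_zero.mpr hdetC) k
  have hBc : (fun t => toComplex (bifidBlock A Q t)) = fun t => bifidMatrix (Gc t) :=
    funext fun t => toComplex_bifidMatrix _
  have hne {k l : Fin 8} (hkl : k ≠ l) : polarVec G (O k) (O l) ≠ 0 := by
    intro h
    refine hO.polarVec_ne_zero hGs hGD hkl ?_
    rw [polarVec_toComplex, h]
    ext; simp
  refine ⟨hunit, hO, ?_, fun i hi j h => ?_, fun O' hO' => ⟨?_, ?_, ?_⟩⟩
  · ext1 i j
    rw [bitangentMatrix_apply, bitangentMatrix_apply, polarVec_normalizedOctad A hunit]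
  · exact hO.entry_ne_zero hGs hGD hbase hi j (by simp [toComplex, h])
  · rw [hBc]
    refine (hO.cremonaOctad hGs hGD hbase).of_samePoints ?_
    rw [← toComplex_cremonaOctad]
    exact hO'.toComplex
  · intro i j k l h
    -- The index set has four elements, so no index repeats; `hne` needs this.
    have hkl : k ≠ l := by
      rintro rfl
      have h1 : ({i, j, k, k} : Finset (Fin 8)).card ≤ 3 := by
        rw [Finset.insert_eq_of_mem (a := k) (s := {k}) (by simp)]
        exact Finset.card_le_three
      rcases h with h | h <;> rw [h] at h1 <;> exact absurd h1 (by decide)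
    refine exists_smul_bitangentMatrix hO' (hne hkl) ?_
    rw [hBc, toComplex_cremonaOctad]
    rcases h with h | h
    · exact ⟨1, one_ne_zero, by rw [one_smul]; exact polarVec_bifid_coordinate hGs hbase h⟩
    · have hmem (m : Fin 8) (hm : m ∈ ({i, j, k, l} : Finset (Fin 8))) : 4 ≤ m.val := by
        rw [h] at hm
        revert m; decide
      refine hO.polarVec_complementary hGs hGD hbase (hmem i (by simp)) (hmem j (by simp))
        (hmem k (by simp)) (hmem l (by simp)) ?_
      have hcard : ({i, j, k, l} : Finset (Fin 8)).card = 4 := by rw [h]; rfl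
      clear hmem h hkl
      revert i j k l
      decide
  · intro i j hij h
    have hcases : i.val < 4 ∧ 4 ≤ j.val ∨ j.val < 4 ∧ 4 ≤ i.val := by
      revert i j; decide
    refine exists_smul_bitangentMatrix hO' (hne hij) ?_
    rw [hBc, toComplex_cremonaOctad]
    rcases hcases with ⟨hi, hj⟩ | ⟨hj, hi⟩
    · exact hO.polarVec_bifid_mixed hGs hGD hbase hi hj
    · have h1 := hO.polarVec_bifid_mixed hGs hGD hbase hj hi
      rwa [polarVec_comm (fun t => bifidMatrix_isSymm (Gc t)), polarVec_comm hGs] at h1
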